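/- **Regular insurance model.** Let $S$ be a Polish space with Borel $\sigma$-algebra $\mathscr S$ and let $(\Omega,\mathscr F,(\mathscr F_t)_{t\ge0},P)$ be a filtered probability space. Let $q_t(x,dh)$, $t\ge 0$, $x\in S$, be a family of finite positive measures on $S$, jointly measurable in $(t,x)$, with $q_t(x,\{x\})=0$, and let $\lambda_t(x)=q_t(x,S\setminus\{x\})$ be the total jump rate; assume that $t\mapsto\lambda_t(x)$ is integrable on compact intervals for each $x$. Let $X=(X_t)_{t\ge0}$ be an $(\mathscr F_t)$-adapted $S$-valued process with càdlàg paths that are almost surely piecewise constant with finitely many jumps in each compact interval. Suppose that $X$ is a Markov process with respect to $(\mathscr F_t)$ and $P$, with regular conditional probabilities $\nu_t(g,\cdot)=P(\,\cdot\mid X_t=g)$. These are defined for every $t\ge 0$ and every $g\in S$; under each $\nu_t(g,\cdot)$ one has $X_t=g$ almost surely, the paths are almost surely piecewise constant as above, and $(X_s)_{s\ge t}$ is Markov: given $(X_r)_{t\le r\le u}$, events depending on $(X_s)_{s\ge u}$ have conditional probability $\nu_u(X_u,\cdot)$. Suppose that $q$ is the jump intensity of $X$: with $J_t$ the first jump time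 of $X$ in $[t,\infty)$, for all $g\in S$, $u\ge t$ and $C\in\mathscr S$, $$\nu_t(g,\{J_t>u\})=e^{-\int_t^u\lambda_s(g)\,ds},\qquad \nu_t(g,\{J_t\le u,\;X_{J_t}\in C\})=\int_t^u e^{-\int_t^s\lambda_w(g)\,dw}\,q_s(g,C)\,ds$$ (that is, given that the next jump occurs at time $s$, the new state has law $q_s(g,\cdot)/\lambda_s(g)$). Let $B:[0,\infty)\times S\to\mathbb R$, $(t,g)\mapsto B_g(t)$ (accumulated sojourn payments), and $b:[0,\infty)\times S\times S\to\mathbb R$, $(t,g,h)\mapsto b_{gh}(t)$ (transition payments), be measurable and of bounded variation in $t$ on compact intervals. Integrals $dB_g$ are Lebesgue–Stieltjes integrals on $[0,\infty)$, with the convention $B_g(0-)=0$. **Reserve.** Let $r:[0,\infty)\to\mathbb R$ be integrable on compact intervals and $v(t,s)=e^{-\int_t^s r(u)\,du}$. The present value of future payments is $$V(t)=\int_{[t,\infty)}v(t,s)\,dB_{X_s}(s)+\sum_{s\ge t:\;X_{s-}\ne X_s}v(t,s)\,b_{X_{s-}X_s}(s),$$ where $dB_{X_s}(s)$ means $dB_g(s)$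 while $X_s=g$. Assume that for all $t\ge 0$ and $g\in S$, under $\nu_t(g,\cdot)$, the expression for $V(t)$ converges absolutely almost surely and $V(t)$ is integrable, so that the prospective reserve $V_g(t)=E[V(t)\mid X_t=g]=\int_\Omega V(t)\,d\nu_t(g,\cdot)$ is defined. **Theorem.** For every $g\in S$, $$dV_g(t)=(\lambda_t(g)+r(t))\,V_g(t)\,dt-dB_g(t)-\int_S\bigl(b_{gh}(t)+V_h(t)\bigr)\,q_t(g,dh)\,dt .$$ That is, for all $0\le a\le c$: the function $t\mapsto(\lambda_t(g)+r(t))V_g(t)$ is integrable on $[a,c)$; for almost every $t\in[a,c)$ the function $h\mapsto b_{gh}(t)+V_h(t)$ is $q_t(g,\cdot)$-integrable; its integral is an integrable function of $t$ on $[a,c)$; and $$V_g(c)-V_g(a)=\int_a^c(\lambda_t(g)+r(t))V_g(t)\,dt-\int_{[a,c)}dB_g(t)-\int_a^c\int_S\bigl(b_{gh}(t)+V_h(t)\bigr)\,q_t(g,dh)\,dt .$$ -/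

import Mathlib

open MeasureTheory ProbabilityTheory Set Filter Topology
open scoped NNReal ENNReal

noncomputable section

/-- Lebesgue measure `dt` on the time axis `[0, ∞)`. -/
def timeMeasure : Measure ℝ≥0 := Measure.comap ((↑) : ℝ≥0 → ℝ) volume

/-! ### Lebesgue–Stieltjes integration on `[0, ∞)` -/

open scoped Classical in
/-- The signed Lebesgue–Stieltjes measure of `f : [0, ∞) → ℝ` stopped at time `n`, with the usual
convention `f (0-) = 0` (a payment at time `0` counts). For `0 < a ≤ b < n` it gives mass
`f (b-) - f (a-)` to `[a, b)`, and mass `f (b-)` to `[0, b)` if `0 < b < n`. (Mathlib's measure of a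
bounded variation function uses `f (0-) = f 0`; hence the added Dirac mass.) -/
def stoppedStieltjes (f : ℝ≥0 → ℝ) (n : ℕ) : SignedMeasure ℝ≥0 :=
  if h : BoundedVariationOn (fun s : ℝ≥0 => f (min s n)) univ then
    h.vectorMeasure + VectorMeasure.dirac 0 (f 0)
  else 0

/-- The positive part of the (locally finite) signed Lebesgue–Stieltjes measure `df` of a function
`f` of bounded variation on compact intervals. -/
def stieltjesPos (f : ℝ≥0 → ℝ) : Measure ℝ≥0 :=
  Measure.sum fun n : ℕ =>
    (stoppedStieltjes f (n + 1)).toJordanDecomposition.posPart.restrict (Ico (n : ℝ≥0) (n + 1))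

/-- The negative part of the signed Lebesgue–Stieltjes measure `df`. -/
def stieltjesNeg (f : ℝ≥0 → ℝ) : Measure ℝ≥0 :=
  Measure.sum fun n : ℕ =>
    (stoppedStieltjes f (n + 1)).toJordanDecomposition.negPart.restrict (Ico (n : ℝ≥0) (n + 1))

/-- The total variation measure `|df|`. -/
def stieltjesVar (f : ℝ≥0 → ℝ) : Measure ℝ≥0 := stieltjesPos f + stieltjesNeg f

/-- The Lebesgue–Stieltjes integral `∫_A φ df`. -/
def stieltjesIntegral (f : ℝ≥0 → ℝ) (A : Set ℝ≥0) (φ : ℝ≥0 → ℝ) : ℝ :=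
  (∫ s in A, φ s ∂stieltjesPos f) - ∫ s in A, φ s ∂stieltjesNeg f

/-! ### Paths -/

/-- A path is càdlàg: right continuous with left limits. -/
def IsCadlagPath {S : Type*} [TopologicalSpace S] (x : ℝ≥0 → S) : Prop :=
  ∀ t, ContinuousWithinAt x (Ici t) t ∧ ∃ y, Tendsto x (𝓝[<] t) (𝓝 y)

/-- A path is right continuous and piecewise constant with finitely many jumps in each compact
interval: to the right and to the left of every time it is constant for a while. -/
def IsPiecewiseConstantPath {S : Type*} (x : ℝ≥0 → S) : Prop :=
  ∀ t, (∀ᶠ s in 𝓝[>] t, x s = x t) ∧ ∃ y, ∀ᶠ s in 𝓝[<] t, x s = y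

/-- The path `x` jumps at time `s`, i.e. `x (s-) ≠ x s`; never true at `s = 0`. -/
def IsJumpTime {S : Type*} [TopologicalSpace S] (x : ℝ≥0 → S) (s : ℝ≥0) : Prop :=
  Function.leftLim x s ≠ x s

/-- `s` is the first jump time of the path `x` in `[t, ∞)`. -/
def IsFirstJumpTimeFrom {S : Type*} [TopologicalSpace S] (x : ℝ≥0 → S) (t s : ℝ≥0) : Prop :=
  t ≤ s ∧ IsJumpTime x s ∧ ∀ u, t ≤ u → u < s → ¬ IsJumpTime x u

/-! ### The insurance model -/

/-- A regular insurance model with state space `S` on the measurable space `Ω`. -/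
structure RegularInsuranceModel (S : Type*) [TopologicalSpace S] [PolishSpace S]
    [MeasurableSpace S] [BorelSpace S] (Ω : Type*) [mΩ : MeasurableSpace Ω] where
  /-- The underlying probability measure. -/
  P : Measure Ω
  isProbabilityMeasure_P : IsProbabilityMeasure P
  /-- The filtration. -/
  𝓕 : Filtration ℝ≥0 mΩ
  /-- The jump intensity kernel `q_t(x, dh)`: finite positive measures without mass at `x`. -/
  q : Kernel (ℝ≥0 × S) S
  isFiniteMeasure_q : ∀ t x, IsFiniteMeasure (q (t, x))
  q_self : ∀ t x, q (t, x) {x} = 0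
  /-- The total jump rate out of a fixed state is integrable in time over compact intervals. -/
  locallyIntegrable_rate : ∀ x, LocallyIntegrable (fun t => (q (t, x)).real {x}ᶜ) timeMeasure
  /-- The state process. -/
  X : ℝ≥0 → Ω → S
  measurable_X : ∀ t, Measurable[𝓕 t] (X t)
  cadlag : ∀ ω, IsCadlagPath (fun t => X t ω)
  piecewiseConstant : ∀ᵐ ω ∂P, IsPiecewiseConstantPath (fun t => X t ω)
  /-- `ν t g = P(· | X_t = g)`: regular conditional probabilities given the state at time `t`. -/
  ν : ℝ≥0 → Kernel S Ω
  isMarkovKernel_ν : ∀ t, IsMarkovKernel (ν t)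
  disintegration : ∀ t (A : Set Ω) (C : Set S), MeasurableSet A → MeasurableSet C →
    P (A ∩ X t ⁻¹' C) = ∫⁻ h in C, ν t h A ∂(P.map (X t))
  /-- The Markov property with respect to the filtration `𝓕` and `P`. -/
  markov : ∀ t (D A : Set Ω), MeasurableSet[𝓕 t] D →
    MeasurableSet[⨆ s ∈ Ici t, MeasurableSpace.comap (X s) inferInstance] A →
    P (D ∩ A) = ∫⁻ ω in D, ν t (X t ω) A ∂P
  /-- Under `P(· | X_t = g)` the process is in `g` at time `t`; this and the following conditions
  hold for *every* state `g`, so that conditioning on `X_t = g` has a definite meaning. -/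
  ν_start : ∀ t g, ∀ᵐ ω ∂(ν t g), X t ω = g
  ν_piecewiseConstant : ∀ t g, ∀ᵐ ω ∂(ν t g), IsPiecewiseConstantPath (fun s => X s ω)
  /-- Under `P(· | X_t = g)` the process `(X_s)_{s ≥ t}` is a Markov process with the same
  transition mechanism. -/
  ν_markov : ∀ t u g (D A : Set Ω), t ≤ u →
    MeasurableSet[⨆ s ∈ Icc t u, MeasurableSpace.comap (X s) inferInstance] D →
    MeasurableSet[⨆ s ∈ Ici u, MeasurableSpace.comap (X s) inferInstance] A →
    ν t g (D ∩ A) = ∫⁻ ω in D, ν u (X u ω) A ∂(ν t g)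
  /-- `q` is the jump intensity, part 1: given `X_t = g`, the survival function of the next jump
  time is `exp (-∫_t^u λ_s(g) ds)`. -/
  survival : ∀ t u g, t ≤ u →
    ν t g {ω | ∀ s ∈ Icc t u, ¬ IsJumpTime (fun w => X w ω) s} =
      ENNReal.ofReal (Real.exp (-∫ s in Ico t u, (q (s, g)).real {g}ᶜ ∂timeMeasure))
  /-- `q` is the jump intensity, part 2: given `X_t = g` and given that the next jump happens at
  time `s`, the new state has the distribution `q_s(g, ·) / λ_s(g)`; written as the joint law of the
  next jump time and the new state. -/
  jump_law : ∀ t u g (C : Set S), t ≤ u → MeasurableSet C →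
    ν t g {ω | ∃ s ∈ Icc t u, IsFirstJumpTimeFrom (fun w => X w ω) t s ∧ X s ω ∈ C} =
      ∫⁻ s in Icc t u,
        ENNReal.ofReal (Real.exp (-∫ w in Ico t s, (q (w, g)).real {g}ᶜ ∂timeMeasure)) *
          q (s, g) C ∂timeMeasure
  /-- `B t g = B_g(t)`: the accumulated sojourn payments in state `g`. -/
  B : ℝ≥0 → S → ℝ
  measurable_B : Measurable (Function.uncurry B)
  locallyBoundedVariationOn_B : ∀ g, LocallyBoundedVariationOn (fun t => B t g) univ
  /-- `b t g h = b_{gh}(t)`: the payment upon a transition from `g` to `h` at time `t`. -/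
  b : ℝ≥0 → S → S → ℝ
  measurable_b : Measurable (fun p : ℝ≥0 × S × S => b p.1 p.2.1 p.2.2)
  locallyBoundedVariationOn_b : ∀ g h, LocallyBoundedVariationOn (fun t => b t g h) univ

/-- The discount function `v(t, s) = exp (-∫_t^s r(u) du)`, for `t ≤ s`. -/
def discount (r : ℝ≥0 → ℝ) (t s : ℝ≥0) : ℝ := Real.exp (-∫ u in Ico t s, r u ∂timeMeasure)

namespace RegularInsuranceModel

variable {S : Type*} [TopologicalSpace S] [PolishSpace S] [MeasurableSpace S] [BorelSpace S]
  {Ω : Type*} [MeasurableSpace Ω]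

/-- The total jump rate `λ_t(g) = q_t(g, S \ {g})`. -/
def rate (M : RegularInsuranceModel S Ω) (t : ℝ≥0) (g : S) : ℝ := (M.q (t, g)).real {g}ᶜ

/-- The discounted sojourn payments `∫_{[t, ∞)} v(t, s) dB_{x_s}(s)` along a path `x`: during the
sojourns in `g` the payments are those of the stream `B_g`. The sum has only countably many nonzero
terms, since a piecewise constant path visits only countably many states. -/
def sojournValue (M : RegularInsuranceModel S Ω) (r : ℝ≥0 → ℝ) (t : ℝ≥0) (x : ℝ≥0 → S) : ℝ :=
  ∑' g : S, stieltjesIntegral (fun s => M.B s g) {s | t ≤ s ∧ x s = g} (discount r t)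

/-- The discounted transition payments: the sum of `v(t, s) b_{x_{s-}, x_s}(s)` over all jump times
`s ≥ t` of the path `x`. -/
def transitionValue (M : RegularInsuranceModel S Ω) (r : ℝ≥0 → ℝ) (t : ℝ≥0) (x : ℝ≥0 → S) : ℝ :=
  ∑' s : {s : ℝ≥0 // t ≤ s ∧ IsJumpTime x s},
    discount r t s * M.b s (Function.leftLim x s) (x s)

/-- The present value `V(t)` of future cash flows. -/
def presentValue (M : RegularInsuranceModel S Ω) (r : ℝ≥0 → ℝ) (t : ℝ≥0) (ω : Ω) : ℝ :=
  M.sojournValue r t (fun s => M.X s ω) + M.transitionValue r t (fun s => M.X s ω)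

/-- The total variation of the discounted payments in `[t, ∞)`. The Lebesgue–Stieltjes integral
defining `V(t)` converges (absolutely) iff this is finite. -/
def presentVariation (M : RegularInsuranceModel S Ω) (r : ℝ≥0 → ℝ) (t : ℝ≥0) (ω : Ω) : ℝ≥0∞ :=
  (∑' g : S, ∫⁻ s in {s | t ≤ s ∧ M.X s ω = g},
      ENNReal.ofReal (discount r t s) ∂stieltjesVar (fun s => M.B s g)) +
    ∑' s : {s : ℝ≥0 // t ≤ s ∧ IsJumpTime (fun w => M.X w ω) s},
      ENNReal.ofReal (discount r t s *
        |M.b s (Function.leftLim (fun w => M.X w ω) s) (M.X s ω)|)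

/-- The prospective reserve `V_g(t) = E[V(t) | X_t = g]`. -/
def reserve (M : RegularInsuranceModel S Ω) (r : ℝ≥0 → ℝ) (t : ℝ≥0) (g : S) : ℝ :=
  ∫ ω, M.presentValue r t ω ∂(M.ν t g)

end RegularInsuranceModel

end

/-!
Thiele's equation is obtained by conditioning on the first jump after `a`. Let `p` be the
probability of staying in `g` from `a` on, `v` the discount factor, `E = p v`, and `k(t) = ∫
(b_{gh}(t) + V_h(t)) q_t(g, dh)`. If `g` is not left before `c`, then `V(a)` consists of the
payments `∫_{[a,c)} v dB_g` and of `v V(c)`, whose conditional expectation is `v V_g(c)` by the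
Markov property. If `g` is left at time `s` for the state `h`, then the conditional expectation of
`V(a)` is `∫_{[a,s)} v dB_g + v(s) (b_{gh}(s) + V_h(s))`. The law of `(s, h)` is known, so
`reserve_eq_add_integral_jumpLaw` follows; Fubini's theorem turns it into `V_g(a) = ∫_{[a,c)} E
dB_g + ∫_a^c E k dt + E(c) V_g(c)` (`discounted_thiele`). Solving for `V_g(c)` and integrating by
parts against `1 / E`, which has the derivative `(λ + r) / E`, gives the theorem.

The delicate point is the conditional expectation after the jump, since the model has the Markov
property at fixed times only. The jump time is approximated from the right by the next point of a
grid. On the event that the first jump falls into a given cell of the grid and that the state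
reached is kept until the end of the cell, the ordinary Markov property applies
(`setIntegral_cellEvent`). As the mesh goes to zero these events exhaust the event of a jump,
because paths are piecewise constant, and the reserves at the grid points, together with the
payments up to them, converge to `V_h(s)` (`tendsto_stayValue_add_reserve`). No domination is
available, so the marks `(s, h)` are first restricted to sets on which all approximations are
bounded by a constant; an exhaustion then yields both integrability and the identity
(`integrableOn_valueGivenJump_and_setIntegral_eq`).

All this requires joint measurability of the payments in time and state. It rests on two facts:
the positive part of a signed measure is a supremum over a countable algebra
(`posPart_apply_eq_iSup`), so that the Lebesgue–Stieltjes measures `dB_g` form a kernel; and the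
states and jump times of a path are enumerated by a dense sequence of times, so that the present
value has a version that is measurable with respect to the future (`futureValue`).
-/

noncomputable section

/-! ### Lebesgue measure on `[0, ∞)` and discount factors -/

lemma measurableEmbedding_nnreal_coe : MeasurableEmbedding ((↑) : ℝ≥0 → ℝ) :=
  MeasurableEmbedding.subtype_coe measurableSet_Ici

lemma timeMeasure_apply (A : Set ℝ≥0) : timeMeasure A = volume (((↑) : ℝ≥0 → ℝ) '' A) :=
  measurableEmbedding_nnreal_coe.comap_apply _ _

lemma map_coe_timeMeasure : timeMeasure.map ((↑) : ℝ≥0 → ℝ) = volume.restrict (Ici 0) := by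
  rw [timeMeasure, measurableEmbedding_nnreal_coe.map_comap]
  congr
  exact Subtype.range_coe

instance : NullSingletonClass timeMeasure := ⟨fun x => by rw [timeMeasure_apply]; simp⟩

instance : IsLocallyFiniteMeasure timeMeasure := by
  refine ⟨fun x => ⟨Iio (x + 1), Iio_mem_nhds (by simp), ?_⟩⟩
  rw [timeMeasure_apply]
  refine (measure_mono (t := Icc (0 : ℝ) (x + 1)) ?_).trans_lt (by simp)
  rintro _ ⟨y, hy, rfl⟩
  exact ⟨y.2, by exact_mod_cast (le_of_lt hy)⟩

lemma MeasureTheory.LocallyIntegrable.integrableOn_Icc_nnreal {r : ℝ≥0 → ℝ} {μ : Measure ℝ≥0}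
    (hr : LocallyIntegrable r μ) (a c : ℝ≥0) : IntegrableOn r (Icc a c) μ :=
  hr.integrableOn_isCompact isCompact_Icc

lemma MeasureTheory.LocallyIntegrable.integrableOn_Ico_nnreal {r : ℝ≥0 → ℝ} {μ : Measure ℝ≥0}
    (hr : LocallyIntegrable r μ) (a c : ℝ≥0) : IntegrableOn r (Ico a c) μ :=
  (hr.integrableOn_Icc_nnreal a c).mono_set Ico_subset_Icc_self

lemma restrict_volume_Ioc_coe (a c : ℝ≥0) :
    volume.restrict (Ioc (a : ℝ) c) = (timeMeasure.restrict (Ioc a c)).map ((↑) : ℝ≥0 → ℝ) := by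
  have h : Ioc a c = ((↑) : ℝ≥0 → ℝ) ⁻¹' Ioc (a : ℝ) c := by ext; simp
  rw [h, ← measurableEmbedding_nnreal_coe.restrict_map, map_coe_timeMeasure,
    Measure.restrict_restrict_of_subset]
  exact fun y hy => a.2.trans hy.1.le

lemma setIntegral_timeMeasure_eq_intervalIntegral (f : ℝ → ℝ) {a c : ℝ≥0} (hac : a ≤ c) :
    ∫ s in Ico a c, f s ∂timeMeasure = ∫ x in (a : ℝ)..c, f x := by
  rw [intervalIntegral.integral_of_le (by exact_mod_cast hac),
    integral_Ico_eq_integral_Ioo, ← integral_Ioc_eq_integral_Ioo, restrict_volume_Ioc_coe,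
    measurableEmbedding_nnreal_coe.integral_map]

lemma intervalIntegrable_toNNReal {r : ℝ≥0 → ℝ} (hr : LocallyIntegrable r timeMeasure)
    (a c : ℝ≥0) : IntervalIntegrable (fun x => r x.toNNReal) volume (a : ℝ) c := by
  wlog hac : a ≤ c
  · exact (this hr c a (le_of_not_ge hac)).symm
  rw [intervalIntegrable_iff_integrableOn_Ioc_of_le (by exact_mod_cast hac), IntegrableOn,
    restrict_volume_Ioc_coe, measurableEmbedding_nnreal_coe.integrable_map_iff]
  have : (fun x : ℝ => r x.toNNReal) ∘ ((↑) : ℝ≥0 → ℝ) = r := by ext; simp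
  rw [this]
  exact (hr.integrableOn_Icc_nnreal a c).mono_set Ioc_subset_Icc_self

lemma integral_Ico_add {r : ℝ≥0 → ℝ} (hr : LocallyIntegrable r timeMeasure) {a b c : ℝ≥0}
    (hab : a ≤ b) (hbc : b ≤ c) :
    ∫ s in Ico a c, r s ∂timeMeasure =
      (∫ s in Ico a b, r s ∂timeMeasure) + ∫ s in Ico b c, r s ∂timeMeasure := by
  rw [← Ico_union_Ico_eq_Ico hab hbc, setIntegral_union (by simp) measurableSet_Ico
    (hr.integrableOn_Ico_nnreal _ _) (hr.integrableOn_Ico_nnreal _ _)]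

lemma discount_pos (r : ℝ≥0 → ℝ) (t s : ℝ≥0) : 0 < discount r t s := Real.exp_pos _

lemma discount_of_le (r : ℝ≥0 → ℝ) {t s : ℝ≥0} (h : s ≤ t) : discount r t s = 1 := by
  simp [discount, Ico_eq_empty_of_le h]

lemma discount_self (r : ℝ≥0 → ℝ) (t : ℝ≥0) : discount r t t = 1 := discount_of_le r le_rfl

lemma discount_mul_discount {r : ℝ≥0 → ℝ} (hr : LocallyIntegrable r timeMeasure) {a b c : ℝ≥0}
    (hab : a ≤ b) (hbc : b ≤ c) : discount r a b * discount r b c = discount r a c := by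
  simp only [discount]
  rw [← Real.exp_add, integral_Ico_add hr hab hbc, neg_add]

lemma discount_add {r l : ℝ≥0 → ℝ} (hr : LocallyIntegrable r timeMeasure)
    (hl : LocallyIntegrable l timeMeasure) (a c : ℝ≥0) :
    discount (fun s => r s + l s) a c = discount r a c * discount l a c := by
  simp only [discount]
  rw [← Real.exp_add, integral_add (hr.integrableOn_Ico_nnreal _ _)
    (hl.integrableOn_Ico_nnreal _ _), neg_add]

lemma discount_neg (r : ℝ≥0 → ℝ) (a c : ℝ≥0) :
    discount (fun s => -r s) a c = (discount r a c)⁻¹ := by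
  simp only [discount]
  rw [integral_neg, ← Real.exp_neg]

lemma discount_eq_intervalIntegral (r : ℝ≥0 → ℝ) {a c : ℝ≥0} (hac : a ≤ c) :
    discount r a c = Real.exp (-∫ x in (a : ℝ)..c, r x.toNNReal) := by
  rw [discount, ← setIntegral_timeMeasure_eq_intervalIntegral _ hac]
  simp

lemma absolutelyContinuous_exp_comp {f : ℝ → ℝ} {a b : ℝ}
    (hf : AbsolutelyContinuousOnInterval f a b) :
    AbsolutelyContinuousOnInterval (fun x => Real.exp (f x)) a b := by
  obtain ⟨C, hC⟩ := hf.exists_bound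
  have hlip : ∀ x ∈ uIcc a b, ∀ y ∈ uIcc a b,
      dist (Real.exp (f x)) (Real.exp (f y)) ≤ Real.exp C * dist (f x) (f y) := by
    intro x hx y hy
    have := Convex.norm_image_sub_le_of_norm_deriv_le (f := Real.exp) (s := Iic C)
      (C := Real.exp C) (x := f y) (y := f x) (fun z _ => Real.differentiable_exp z)
      (fun z hz => by simpa [Real.abs_exp] using hz) (convex_Iic C)
      ((le_abs_self _).trans (hC y hy)) ((le_abs_self _).trans (hC x hx))
    simpa [dist_eq_norm] using this
  have hz : Tendsto (fun E : ℕ × (ℕ → ℝ × ℝ) => Real.exp C *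
      ∑ i ∈ Finset.range E.1, dist (f (E.2 i).1) (f (E.2 i).2))
      (AbsolutelyContinuousOnInterval.totalLengthFilter ⊓
        𝓟 (AbsolutelyContinuousOnInterval.disjWithin a b)) (𝓝 0) := by
    simpa using (show Tendsto _ _ _ from hf).const_mul (Real.exp C)
  refine squeeze_zero' (Eventually.of_forall fun E => Finset.sum_nonneg fun _ _ => dist_nonneg)
    ?_ hz
  filter_upwards [mem_inf_of_right (mem_principal_self _)] with E hE
  rw [Finset.mul_sum]
  exact Finset.sum_le_sum fun i hi => hlip _ (hE.1 i hi).1 _ (hE.1 i hi).2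

/-- The fundamental theorem of calculus for a discount factor, whose rate is only locally
integrable: a discount factor is absolutely continuous. -/
lemma setIntegral_mul_discount {r : ℝ≥0 → ℝ} (hr : LocallyIntegrable r timeMeasure)
    {a w c : ℝ≥0} (haw : a ≤ w) (hwc : w ≤ c) :
    ∫ s in Ico w c, r s * discount r a s ∂timeMeasure = discount r a w - discount r a c := by
  have hac := haw.trans hwc
  set R : ℝ → ℝ := fun x => r x.toNNReal with hR
  set D : ℝ → ℝ := fun y => Real.exp (-∫ x in (a : ℝ)..y, R x) with hD
  have hii : IntervalIntegrable R volume a c := intervalIntegrable_toNNReal hr a c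
  have hAC : AbsolutelyContinuousOnInterval D a c :=
    absolutelyContinuous_exp_comp
      (hii.absolutelyContinuousOnInterval_intervalIntegral left_mem_uIcc).fun_neg
  have hwc' : (w : ℝ) ≤ c := by exact_mod_cast hwc
  have haw' : (a : ℝ) ≤ w := by exact_mod_cast haw
  have hac' : (a : ℝ) ≤ c := by exact_mod_cast hac
  have hsub : uIcc (w : ℝ) c ⊆ uIcc (a : ℝ) c := by
    rw [uIcc_of_le hwc', uIcc_of_le hac']
    exact Icc_subset_Icc_left haw'
  have hftc := (hAC.mono hsub).integral_deriv_eq_sub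
  have hder : ∫ x in (w : ℝ)..c, deriv D x = ∫ x in (w : ℝ)..c, -(R x * D x) := by
    refine intervalIntegral.integral_congr_ae ?_
    filter_upwards [hii.ae_hasDerivAt_integral] with x hx hxm
    have hxI : x ∈ uIcc (a : ℝ) c := hsub (uIoc_subset_uIcc hxm)
    have : HasDerivAt D (D x * -R x) x := ((hx hxI a left_mem_uIcc).fun_neg).exp
    rw [this.deriv]
    ring
  have hconv : ∫ s in Ico w c, r s * discount r a s ∂timeMeasure =
      ∫ x in (w : ℝ)..c, R x * D x := by
    rw [← setIntegral_timeMeasure_eq_intervalIntegral _ hwc]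
    refine setIntegral_congr_fun measurableSet_Ico fun s hs => ?_
    simp only [hR, hD, Real.toNNReal_coe]
    rw [discount_eq_intervalIntegral r (haw.trans hs.1)]
  rw [hder, intervalIntegral.integral_neg] at hftc
  rw [hconv, discount_eq_intervalIntegral r haw, discount_eq_intervalIntegral r hac]
  simp only [hD, hR] at hftc ⊢
  linarith

lemma continuous_discount {r : ℝ≥0 → ℝ} (hr : LocallyIntegrable r timeMeasure) (a : ℝ≥0) :
    Continuous (discount r a) := by
  have heq : discount r a = fun s : ℝ≥0 =>
      Real.exp (-∫ x in (a : ℝ)..((max a s : ℝ≥0) : ℝ), r x.toNNReal) := by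
    ext s
    rw [← discount_eq_intervalIntegral r (le_max_left a s)]
    rcases le_total a s with h | h
    · rw [max_eq_right h]
    · rw [max_eq_left h, discount_self, discount_of_le r h]
  rw [heq, continuous_iff_continuousAt]
  intro s₀
  set N : ℝ≥0 := max a s₀ + 1
  have hcont := intervalIntegral.continuousOn_primitive_interval'
    (intervalIntegrable_toNNReal hr a N) (a := (a : ℝ)) left_mem_uIcc
  have hmaps : MapsTo (fun s : ℝ≥0 => ((max a s : ℝ≥0) : ℝ)) (Iio N) (uIcc (a : ℝ) N) := by
    intro s hs
    have haN : a ≤ N := (le_max_left a s₀).trans le_self_add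
    rw [uIcc_of_le (by exact_mod_cast haN)]
    exact ⟨by exact_mod_cast le_max_left a s, by exact_mod_cast max_le haN (le_of_lt hs)⟩
  have hc : ContinuousOn (fun s : ℝ≥0 => ((max a s : ℝ≥0) : ℝ)) (Iio N) := by fun_prop
  refine ((hcont.comp hc hmaps).neg.rexp).continuousAt (Iio_mem_nhds ?_)
  exact lt_of_le_of_lt (le_max_right a s₀) (lt_add_one _)

/-! ### Measurable families of Lebesgue–Stieltjes measures -/

/-- Finite measures without a common bound on their masses: the kernel is cut into pieces
according to the integer part of the total mass. -/
lemma isSFiniteKernel_of_forall_isFiniteMeasure {α β : Type*} [MeasurableSpace α]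
    [MeasurableSpace β] (κ : Kernel α β) (h : ∀ a, IsFiniteMeasure (κ a)) :
    IsSFiniteKernel κ := by
  have hmeas : Measurable fun a => ⌊(κ a univ).toReal⌋₊ :=
    Nat.measurable_floor.comp (κ.measurable_coe MeasurableSet.univ).ennreal_toReal
  have hs : ∀ n : ℕ, MeasurableSet {a | ⌊(κ a univ).toReal⌋₊ = n} := fun n =>
    hmeas (measurableSet_singleton n)
  classical
  have hsum : κ = Kernel.sum fun n => Kernel.piecewise (hs n) κ 0 := by
    ext a A hA
    rw [Kernel.sum_apply' _ _ hA, tsum_eq_single ⌊(κ a univ).toReal⌋₊]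
    · simp [Kernel.piecewise_apply]
    · intro n hn
      simp [Kernel.piecewise_apply, hn.symm]
  rw [hsum]
  refine @Kernel.isSFiniteKernel_sum _ _ _ _ _ _ _ fun n =>
    @Kernel.IsFiniteKernel.isSFiniteKernel _ _ _ _ _ ?_
  refine ⟨⟨n + 1, by simp, fun a => ?_⟩⟩
  rw [Kernel.piecewise_apply]
  split_ifs with ha
  · have h1 : (κ a univ).toReal < n + 1 := by
      have := Nat.lt_floor_add_one (κ a univ).toReal
      rwa [show ⌊(κ a univ).toReal⌋₊ = n from ha] at this
    rw [← ENNReal.ofReal_toReal (measure_ne_top (κ a) univ)]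
    exact (ENNReal.ofReal_le_ofReal h1.le).trans
      (by rw [ENNReal.ofReal_add (by positivity) zero_le_one]; simp)
  · simp

lemma isSFiniteKernel_of_measure_lt_top {α β : Type*} [MeasurableSpace α]
    [MeasurableSpace β] (κ : Kernel α β) (E : ℕ → Set β) (hE : ∀ n, MeasurableSet (E n))
    (hdisj : Pairwise (Function.onFun Disjoint E)) (hcover : ⋃ n, E n = univ)
    (h : ∀ a n, κ a (E n) < ∞) : IsSFiniteKernel κ := by
  have hsum : κ = Kernel.sum fun n => κ.restrict (hE n) := by
    ext a A hA
    rw [Kernel.sum_apply' _ _ hA]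
    simp_rw [Kernel.restrict_apply, Measure.restrict_apply hA]
    rw [← measure_iUnion (fun i j hij => (hdisj hij).mono inter_subset_right inter_subset_right)
      (fun n => hA.inter (hE n)), ← inter_iUnion, hcover, inter_univ]
  rw [hsum]
  refine @Kernel.isSFiniteKernel_sum _ _ _ _ _ _ _ fun n =>
    isSFiniteKernel_of_forall_isFiniteMeasure _ fun a => ?_
  exact ⟨by simpa [Kernel.restrict_apply] using h a n⟩

/-- The positive part of a signed measure is a supremum over a countable algebra of sets that
generates the `σ`-algebra, because the Hahn set can be approximated by sets of the algebra. -/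
lemma posPart_apply_eq_iSup {α : Type*} [mα : MeasurableSpace α] {𝒜 : Set (Set α)}
    (h𝒜 : IsSetAlgebra 𝒜) (hgen : mα = MeasurableSpace.generateFrom 𝒜) (μ : SignedMeasure α)
    {A : Set α} (hA : MeasurableSet A) :
    μ.toJordanDecomposition.posPart A = ⨆ T ∈ 𝒜, ENNReal.ofReal (μ (T ∩ A)) := by
  set p := μ.toJordanDecomposition.posPart with hp
  set n := μ.toJordanDecomposition.negPart with hn
  have hT : ∀ T ∈ 𝒜, MeasurableSet T := fun T h =>
    hgen ▸ MeasurableSpace.measurableSet_generateFrom h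
  have hval : ∀ E, MeasurableSet E → μ E = p.real E - n.real E := fun E hE =>
    μ.apply_eq_posPart_real_sub_negPart_real hE
  apply le_antisymm
  · obtain ⟨Z, hZ, hpZ, hnZ⟩ := μ.toJordanDecomposition.mutuallySingular
    refine ENNReal.le_of_forall_pos_le_add fun ε hε _ => ?_
    -- `Zᶜ` is a Hahn set carrying the positive part, and `T` approximates it
    obtain ⟨T, hT𝒜, hTε⟩ := (Measure.MeasureDense.of_generateFrom_isSetAlgebra_finite (p + n) h𝒜
      hgen).approx Zᶜ hZ.compl (measure_ne_top _ _) (ε / 2) (by positivity)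
    have hTm := hT T hT𝒜
    have hpT : p A ≤ p (T ∩ A) + ENNReal.ofReal (ε / 2) := by
      calc p A ≤ p (T ∩ A ∪ (Zᶜ \ T ∪ Z)) := by
            refine measure_mono fun x hx => ?_
            by_cases h1 : x ∈ T <;> by_cases h2 : x ∈ Z <;> simp [*]
        _ ≤ p (T ∩ A) + (p (Zᶜ \ T) + p Z) :=
            (measure_union_le _ _).trans (by gcongr; exact measure_union_le _ _)
        _ ≤ p (T ∩ A) + ENNReal.ofReal (ε / 2) := by
            gcongr
            rw [hpZ, add_zero]
            refine le_trans ?_ hTε.le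
            refine (measure_mono (t := symmDiff Zᶜ T) subset_union_left).trans ?_
            exact Measure.le_add_right le_rfl _
    have hnT : n (T ∩ A) ≤ ENNReal.ofReal (ε / 2) := by
      calc n (T ∩ A) ≤ n (T \ Zᶜ ∪ Zᶜ) := by
            refine measure_mono fun x hx => ?_
            by_cases h2 : x ∈ Z <;> simp [hx.1, h2]
        _ ≤ n (T \ Zᶜ) + n Zᶜ := measure_union_le _ _
        _ ≤ ENNReal.ofReal (ε / 2) := by
            rw [hnZ, add_zero]
            refine le_trans ?_ hTε.le
            refine (measure_mono (t := symmDiff Zᶜ T) subset_union_right).trans ?_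
            exact Measure.le_add_left le_rfl _
    have hε2 : ENNReal.ofReal ((ε : ℝ) / 2) + ENNReal.ofReal ((ε : ℝ) / 2) = ε := by
      rw [← ENNReal.ofReal_add (by positivity) (by positivity), add_halves,
        ENNReal.ofReal_coe_nnreal]
    have hkey : p (T ∩ A) ≤ ENNReal.ofReal (μ (T ∩ A)) + ENNReal.ofReal (ε / 2) := by
      have h1 : p.real (T ∩ A) ≤ μ (T ∩ A) + ε / 2 := by
        have : n.real (T ∩ A) ≤ ε / 2 := ENNReal.toReal_le_of_le_ofReal (by positivity) hnT
        rw [hval _ (hTm.inter hA)]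
        linarith
      rw [← ENNReal.ofReal_toReal (measure_ne_top p (T ∩ A))]
      exact (ENNReal.ofReal_le_ofReal h1).trans ENNReal.ofReal_add_le
    calc p A ≤ p (T ∩ A) + ENNReal.ofReal (ε / 2) := hpT
      _ ≤ ENNReal.ofReal (μ (T ∩ A)) + ENNReal.ofReal (ε / 2) + ENNReal.ofReal (ε / 2) := by gcongr
      _ = ENNReal.ofReal (μ (T ∩ A)) + ε := by rw [add_assoc, hε2]
      _ ≤ _ := by
        gcongr
        exact le_iSup₂ (f := fun T (_ : T ∈ 𝒜) => ENNReal.ofReal (μ (T ∩ A))) T hT𝒜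
  · refine iSup₂_le fun T hT𝒜 => ?_
    rw [hval _ ((hT T hT𝒜).inter hA)]
    calc ENNReal.ofReal (p.real (T ∩ A) - n.real (T ∩ A))
        ≤ ENNReal.ofReal (p.real (T ∩ A)) := by
          gcongr
          linarith [measureReal_nonneg (μ := n) (s := T ∩ A)]
      _ = p (T ∩ A) := ENNReal.ofReal_toReal (measure_ne_top _ _)
      _ ≤ p A := measure_mono inter_subset_right

lemma measurable_posPart_apply {α ι : Type*} [mα : MeasurableSpace α] [MeasurableSpace ι]
    [MeasurableSpace.CountablyGenerated α] (μ : ι → SignedMeasure α)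
    (hμ : ∀ A, MeasurableSet A → Measurable fun i => μ i A) {A : Set α} (hA : MeasurableSet A) :
    Measurable fun i => (μ i).toJordanDecomposition.posPart A := by
  obtain ⟨b, hbc, hb⟩ := MeasurableSpace.CountablyGenerated.isCountablyGenerated (α := α)
  have halg : IsSetAlgebra (generateSetAlgebra b) := isSetAlgebra_generateSetAlgebra
  have hgen : mα = MeasurableSpace.generateFrom (generateSetAlgebra b) := by
    rw [hb, generateFrom_generateSetAlgebra_eq]
  simp_rw [posPart_apply_eq_iSup halg hgen _ hA]
  refine Measurable.biSup _ (countable_generateSetAlgebra hbc) fun T hT => ?_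
  have hTm : MeasurableSet T := hgen ▸ MeasurableSpace.measurableSet_generateFrom hT
  exact (hμ _ (hTm.inter hA)).ennreal_ofReal

lemma boundedVariationOn_stopped {f : ℝ≥0 → ℝ} (hf : LocallyBoundedVariationOn f univ) (n : ℕ) :
    BoundedVariationOn (fun s : ℝ≥0 => f (min s n)) univ := by
  have h := hf 0 n (mem_univ _) (mem_univ _)
  rw [univ_inter] at h
  refine ne_top_of_le_ne_top h (eVariationOn.comp_le_of_monotoneOn f (t := univ)
    (fun s : ℝ≥0 => min s n) ?_ ?_)
  · exact fun x _ y _ hxy => min_le_min_right _ hxy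
  · exact fun x _ => ⟨zero_le, min_le_right _ _⟩

/-- The mass of `[0, u)` is a limit of values of `B` at times left of `u`, and the intervals
`[0, u)` generate the Borel sets. -/
lemma measurable_stoppedStieltjes {S : Type*} [MeasurableSpace S] {B : ℝ≥0 → S → ℝ}
    (hB : ∀ t, Measurable (B t)) (hbv : ∀ g, LocallyBoundedVariationOn (fun t => B t g) univ)
    (n : ℕ) {A : Set ℝ≥0} (hA : MeasurableSet A) :
    Measurable fun g => stoppedStieltjes (fun t => B t g) n A := by
  have hbasic : ∀ u : ℝ≥0, Measurable fun g => stoppedStieltjes (fun t => B t g) n (Iio u) := by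
    intro u
    have hll : ∀ u : ℝ≥0, Measurable fun g =>
        Function.leftLim (fun s : ℝ≥0 => B (min s n) g) u := by
      intro u
      rcases eq_or_ne u 0 with rfl | hu
      · have : ∀ g, Function.leftLim (fun s : ℝ≥0 => B (min s n) g) 0 = B (min 0 n) g := fun g =>
          leftLim_eq_of_isBot isBot_bot
        simp_rw [this]
        exact hB _
      · obtain ⟨v, -, hvu, hv⟩ := exists_seq_strictMono_tendsto' (pos_iff_ne_zero.2 hu)
        refine measurable_of_tendsto_metrizable (f := fun k g => B (min (v k) n) g)
          (fun k => hB _) ?_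
        rw [tendsto_pi_nhds]
        intro g
        have h1 := (boundedVariationOn_stopped (hbv g) n).tendsto_leftLim u
        exact h1.comp (tendsto_nhdsWithin_of_tendsto_nhds_of_eventually_within _ hv
          (Eventually.of_forall fun k => (hvu k).2))
    have heq : ∀ g, stoppedStieltjes (fun t => B t g) n (Iio u) =
        Function.leftLim (fun s : ℝ≥0 => B (min s n) g) u
          - Function.leftLim (fun s : ℝ≥0 => B (min s n) g) 0
          + (VectorMeasure.dirac (0 : ℝ≥0) (B 0 g)) (Iio u) := by
      intro g
      rw [stoppedStieltjes, dif_pos (boundedVariationOn_stopped (hbv g) n)]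
      rw [add_apply, show Iio u = Ico 0 u by ext; simp,
        BoundedVariationOn.vectorMeasure_Ico _ zero_le]
    simp_rw [heq]
    refine ((hll u).sub (hll 0)).add ?_
    by_cases h0 : (0 : ℝ≥0) ∈ Iio u
    · simp_rw [VectorMeasure.dirac_apply_of_mem measurableSet_Iio h0]
      exact hB 0
    · simp_rw [VectorMeasure.dirac_apply_of_notMem h0]
      exact measurable_const
  have huniv : Measurable fun g => stoppedStieltjes (fun t => B t g) n univ := by
    refine measurable_of_tendsto_metrizable
      (f := fun (k : ℕ) g => stoppedStieltjes (fun t => B t g) n (Iio (k : ℝ≥0)))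
      (fun k => hbasic _) ?_
    rw [tendsto_pi_nhds]
    intro g
    have h := (stoppedStieltjes (fun t => B t g) n).tendsto_vectorMeasure_iUnion_atTop_nat
      (s := fun k : ℕ => Iio (k : ℝ≥0)) (fun i j hij => Iio_subset_Iio (by exact_mod_cast hij))
      (fun _ => measurableSet_Iio)
    have hU : ⋃ k : ℕ, Iio (k : ℝ≥0) = univ := by
      ext x
      simpa using exists_nat_gt x
    rwa [hU] at h
  induction A, hA using MeasurableSpace.induction_on_inter
    (borel_eq_generateFrom_Iio ℝ≥0 ▸ BorelSpace.measurable_eq) isPiSystem_Iio with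
  | empty => simp
  | basic t ht => obtain ⟨u, rfl⟩ := ht; exact hbasic u
  | compl t ht ih =>
    have : ∀ g, stoppedStieltjes (fun t => B t g) n tᶜ =
        stoppedStieltjes (fun t => B t g) n univ - stoppedStieltjes (fun t => B t g) n t := by
      intro g
      rw [eq_sub_iff_add_eq, ← VectorMeasure.of_union disjoint_compl_left ht.compl ht,
        compl_union_self]
    simp_rw [this]
    exact huniv.sub ih
  | iUnion f hd hm ih =>
    refine measurable_of_tendsto_metrizable
      (f := fun (k : ℕ) g => ∑ i ∈ Finset.range k, stoppedStieltjes (fun t => B t g) n (f i))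
      (fun k => Finset.measurable_sum _ fun i _ => ih i) ?_
    rw [tendsto_pi_nhds]
    intro g
    exact ((stoppedStieltjes (fun t => B t g) n).m_iUnion hm hd).tendsto_sum_nat

section

variable {S : Type*} [MeasurableSpace S] {B : ℝ≥0 → S → ℝ}

lemma measurable_stieltjesPos (hB : ∀ t, Measurable (B t))
    (hbv : ∀ g, LocallyBoundedVariationOn (fun t => B t g) univ) :
    Measurable fun g => stieltjesPos fun t => B t g := by
  refine Measure.measurable_of_measurable_coe _ fun A hA => ?_
  simp_rw [stieltjesPos, Measure.sum_apply _ hA, Measure.restrict_apply hA]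
  exact Measurable.tsum fun n => measurable_posPart_apply _
    (fun E hE => measurable_stoppedStieltjes hB hbv _ hE) (hA.inter measurableSet_Ico)

lemma measurable_stieltjesNeg (hB : ∀ t, Measurable (B t))
    (hbv : ∀ g, LocallyBoundedVariationOn (fun t => B t g) univ) :
    Measurable fun g => stieltjesNeg fun t => B t g := by
  refine Measure.measurable_of_measurable_coe _ fun A hA => ?_
  simp_rw [stieltjesNeg, Measure.sum_apply _ hA, Measure.restrict_apply hA]
  refine Measurable.tsum fun n => ?_
  have h := measurable_posPart_apply (fun g => -stoppedStieltjes (fun t => B t g) (n + 1))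
    (fun E hE => by
      simpa only [neg_apply] using! (measurable_stoppedStieltjes hB hbv (n + 1) hE).neg)
    (hA.inter (measurableSet_Ico (a := (n : ℝ≥0)) (b := n + 1)))
  simpa only [SignedMeasure.toJordanDecomposition_neg, JordanDecomposition.neg_posPart] using h

end

lemma sum_restrict_Ico_lt_top (m : ℕ → Measure ℝ≥0) [∀ n, IsFiniteMeasure (m n)] (c : ℝ≥0) :
    (Measure.sum fun n : ℕ => (m n).restrict (Ico (n : ℝ≥0) (n + 1))) (Iio c) < ∞ := by
  obtain ⟨N, hN⟩ := exists_nat_gt c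
  rw [Measure.sum_apply _ measurableSet_Iio, tsum_eq_sum (s := Finset.range N)]
  · exact ENNReal.sum_lt_top.2 fun n _ => measure_lt_top _ _
  · intro n hn
    rw [Measure.restrict_apply measurableSet_Iio]
    convert measure_empty (μ := m n)
    ext x
    simp only [mem_inter_iff, mem_Iio, mem_Ico, mem_empty_iff_false, iff_false]
    rintro ⟨hx, hnx, -⟩
    have hNn : (N : ℝ≥0) ≤ n := by exact_mod_cast not_lt.1 (by simpa using hn)
    exact absurd (hN.trans_le (hNn.trans hnx)) (not_lt.2 hx.le)

lemma stieltjesPos_Iio_lt_top (f : ℝ≥0 → ℝ) (c : ℝ≥0) : stieltjesPos f (Iio c) < ∞ :=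
  sum_restrict_Ico_lt_top _ c

lemma stieltjesNeg_Iio_lt_top (f : ℝ≥0 → ℝ) (c : ℝ≥0) : stieltjesNeg f (Iio c) < ∞ :=
  sum_restrict_Ico_lt_top _ c

instance (f : ℝ≥0 → ℝ) : IsLocallyFiniteMeasure (stieltjesPos f) :=
  ⟨fun x => ⟨Iio (x + 1), Iio_mem_nhds (lt_add_one x), stieltjesPos_Iio_lt_top f _⟩⟩

instance (f : ℝ≥0 → ℝ) : IsLocallyFiniteMeasure (stieltjesNeg f) :=
  ⟨fun x => ⟨Iio (x + 1), Iio_mem_nhds (lt_add_one x), stieltjesNeg_Iio_lt_top f _⟩⟩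

lemma isSFiniteKernel_of_isLocallyFiniteMeasure {S : Type*} [MeasurableSpace S]
    (κ : Kernel S ℝ≥0) (h : ∀ g, IsLocallyFiniteMeasure (κ g)) : IsSFiniteKernel κ := by
  refine isSFiniteKernel_of_measure_lt_top κ (fun n : ℕ => Nat.floor ⁻¹' {n})
    (fun n => Nat.measurable_floor (measurableSet_singleton n)) ?_ ?_ ?_
  · exact fun i j hij => (disjoint_singleton.2 hij).preimage _
  · ext x; simp
  · intro g n
    refine (measure_mono (t := Icc (0 : ℝ≥0) (n + 1)) ?_).trans_lt isCompact_Icc.measure_lt_top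
    rintro x rfl
    exact ⟨zero_le, (Nat.lt_floor_add_one x).le⟩

/-! ### Piecewise constant paths -/

/-- The path `x` leaves, at some time after `q`, the state in which it is at time `q`. -/
def ChangesAfter {S : Type*} (x : ℝ≥0 → S) (q : ℝ≥0) : Prop := ∃ s, q ≤ s ∧ x s ≠ x q

/-- The time at which the path `x` first leaves the state in which it is at time `q`; the value is
`0` if it never does. -/
def firstChange {S : Type*} (x : ℝ≥0 → S) (q : ℝ≥0) : ℝ≥0 := sInf {s | q ≤ s ∧ x s ≠ x q}

section Paths

variable {S : Type*} {x : ℝ≥0 → S} {q t s : ℝ≥0}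

lemma IsPiecewiseConstantPath.exists_right (hx : IsPiecewiseConstantPath x) (t : ℝ≥0) :
    ∃ u, t < u ∧ ∀ s, t ≤ s → s < u → x s = x t := by
  obtain ⟨u, hu, hsub⟩ := mem_nhdsGT_iff_exists_Ioo_subset.1 (hx t).1
  refine ⟨u, hu, fun s hts hsu => ?_⟩
  rcases hts.eq_or_lt with rfl | h
  · rfl
  · exact hsub ⟨h, hsu⟩

lemma IsPiecewiseConstantPath.exists_left (hx : IsPiecewiseConstantPath x) (ht : 0 < t) :
    ∃ y, ∃ p < t, ∀ s, p < s → s < t → x s = y := by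
  obtain ⟨y, hy⟩ := (hx t).2
  obtain ⟨p, hp, hsub⟩ := (mem_nhdsLT_iff_exists_Ioo_subset' ht).1 hy
  exact ⟨y, p, hp, fun s h1 h2 => hsub ⟨h1, h2⟩⟩

lemma eq_of_lt_firstChange (hqs : q ≤ s) (hs : s < firstChange x q) : x s = x q := by
  by_contra h
  exact notMem_of_lt_csInf' hs ⟨hqs, h⟩

lemma firstChange_le (hqs : q ≤ s) (h : x s ≠ x q) : firstChange x q ≤ s :=
  csInf_le' ⟨hqs, h⟩

lemma le_firstChange (h : ChangesAfter x q) : q ≤ firstChange x q :=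
  le_csInf h fun _ hs => hs.1

lemma apply_firstChange_ne (hx : IsPiecewiseConstantPath x) (h : ChangesAfter x q) :
    x (firstChange x q) ≠ x q := by
  intro heq
  obtain ⟨u, hu, hconst⟩ := hx.exists_right (firstChange x q)
  refine (not_le.2 hu) (le_csInf h fun s hs => ?_)
  by_contra hsu
  exact hs.2 ((hconst s (csInf_le' hs) (not_le.1 hsu)).trans heq)

lemma lt_firstChange (hx : IsPiecewiseConstantPath x) (h : ChangesAfter x q) :
    q < firstChange x q :=
  (le_firstChange h).lt_of_ne fun heq => apply_firstChange_ne hx h (by rw [← heq])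

lemma firstChange_eq (hqs : q < s) (hs : x s ≠ x q)
    (hconst : ∀ w, q ≤ w → w < s → x w = x q) : firstChange x q = s := by
  refine le_antisymm (firstChange_le hqs.le hs) (le_csInf ⟨s, hqs.le, hs⟩ fun w hw => ?_)
  by_contra hws
  exact hw.2 (hconst w hw.1 (not_le.1 hws))

instance nhdsLT_neBot_of_pos (t : ℝ≥0) [h : NeZero t] : (𝓝[<] t).NeBot := by
  rw [← mem_closure_iff_nhdsWithin_neBot, closure_Iio' ⟨0, pos_iff_ne_zero.2 h.out⟩]
  exact self_mem_Iic

lemma IsJumpTime.pos [TopologicalSpace S] (h : IsJumpTime x s) : 0 < s := by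
  rw [pos_iff_ne_zero]
  rintro rfl
  exact h (leftLim_eq_of_isBot isBot_bot)

variable [TopologicalSpace S] [T2Space S]

lemma leftLim_eq_of_const (hqs : q < s) {y : S} (h : ∀ w, q < w → w < s → x w = y) :
    Function.leftLim x s = y := by
  have : NeZero s := ⟨(zero_le.trans_lt hqs).ne'⟩
  refine leftLim_eq_of_tendsto (tendsto_const_nhds.congr' ?_)
  filter_upwards [Ioo_mem_nhdsLT hqs] with w hw
  exact (h w hw.1 hw.2).symm

lemma isJumpTime_firstChange (hx : IsPiecewiseConstantPath x) (h : ChangesAfter x q) :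
    Function.leftLim x (firstChange x q) = x q ∧ IsJumpTime x (firstChange x q) := by
  have h1 : Function.leftLim x (firstChange x q) = x q :=
    leftLim_eq_of_const (lt_firstChange hx h) fun w hw hw' => eq_of_lt_firstChange hw.le hw'
  exact ⟨h1, fun h2 => apply_firstChange_ne hx h (h2.symm.trans h1)⟩

lemma IsJumpTime.exists_left (hx : IsPiecewiseConstantPath x) (h : IsJumpTime x s) :
    ∃ p < s, ∀ w, p < w → w < s → x w = Function.leftLim x s := by
  obtain ⟨y, p, hp, hy⟩ := hx.exists_left h.pos
  exact ⟨p, hp, fun w h1 h2 => (hy w h1 h2).trans (leftLim_eq_of_const hp hy).symm⟩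

lemma not_isJumpTime_of_const (hqs : q < s) (h : ∀ w, q < w → w ≤ s → x w = x s) :
    ¬ IsJumpTime x s := fun hj => hj (leftLim_eq_of_const hqs fun w h1 h2 => h w h1 h2.le)

/-- A piecewise constant path without jumps in `(q, s]` is constant on `[q, s]`. -/
lemma eq_of_forall_not_isJumpTime (hx : IsPiecewiseConstantPath x) (hqs : q ≤ s)
    (h : ∀ w, q < w → w ≤ s → ¬ IsJumpTime x w) : x s = x q := by
  by_contra hne
  have hc : ChangesAfter x q := ⟨s, hqs, hne⟩
  exact h _ (lt_firstChange hx hc) (firstChange_le hqs hne) (isJumpTime_firstChange hx hc).2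

end Paths

/-! ### Countable enumeration of the states and jump times of a path -/

/-- A sequence of times that is dense in `[t, ∞)`. -/
def denseTime (t : ℝ≥0) (i : ℕ) : ℝ≥0 := max t (TopologicalSpace.denseSeq ℝ≥0 i)

lemma le_denseTime (t : ℝ≥0) (i : ℕ) : t ≤ denseTime t i := le_max_left _ _

lemma exists_denseTime {t p s : ℝ≥0} (htp : t ≤ p) (hps : p < s) :
    ∃ i, p < denseTime t i ∧ denseTime t i < s := by
  obtain ⟨i, hi⟩ := (TopologicalSpace.denseRange_denseSeq ℝ≥0).exists_mem_open
    isOpen_Ioo (nonempty_Ioo.2 hps)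
  exact ⟨i, lt_max_of_lt_right hi.1, max_lt (htp.trans_lt hps) hi.2⟩

open scoped Classical in
/-- A sum over an uncountable type with countable support, rewritten as a sum over a sequence `e`
that exhausts the support. Only the indices in `V` count, and each value of `e` is counted once, at
its first occurrence. -/
lemma tsum_eq_tsum_first_occurrence {β : Type*} (f : β → ℝ) (e : ℕ → β) (V : ℕ → Prop)
    (h : ∀ b, f b ≠ 0 → ∃ i, V i ∧ e i = b) :
    ∑' b, f b = ∑' i, if V i ∧ ∀ j < i, V j → e j ≠ e i then f (e i) else 0 := by
  set N : Set ℕ := {i | V i ∧ ∀ j < i, V j → e j ≠ e i} with hN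
  have hinj : Function.Injective fun i : N => e i := by
    rintro ⟨i, hi⟩ ⟨j, hj⟩ hij
    simp only at hij
    rcases lt_trichotomy i j with hlt | rfl | hlt
    · exact absurd hij (hj.2 i hlt hi.1)
    · rfl
    · exact absurd hij.symm (hi.2 j hlt hj.1)
  have hsupp : Function.support f ⊆ range fun i : N => e i := by
    intro b hb
    have hex := h b hb
    refine ⟨⟨Nat.find hex, (Nat.find_spec hex).1, fun j hj hVj heq => ?_⟩, (Nat.find_spec hex).2⟩
    exact Nat.find_min hex hj ⟨hVj, heq.trans (Nat.find_spec hex).2⟩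
  rw [← hinj.tsum_eq hsupp, tsum_subtype N (fun i => f (e i))]
  exact tsum_congr fun i => by simp only [indicator_apply, hN, mem_ofPred_eq]

open scoped Classical in
/-- Every jump time after `t` is the first change of state after some point of a dense sequence.
This does not reach a jump at `t` itself. -/
lemma tsum_jumps_eq_enum {S : Type*} [TopologicalSpace S] [T2Space S] {x : ℝ≥0 → S}
    (hx : IsPiecewiseConstantPath x) {t : ℝ≥0} (ht : ¬ IsJumpTime x t) (F : ℝ≥0 → S → S → ℝ) :
    ∑' s : {s : ℝ≥0 // t ≤ s ∧ IsJumpTime x s}, F s (Function.leftLim x s) (x s) =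
      ∑' i, if ChangesAfter x (denseTime t i) ∧ ∀ j < i, ChangesAfter x (denseTime t j) →
          firstChange x (denseTime t j) ≠ firstChange x (denseTime t i)
        then F (firstChange x (denseTime t i)) (x (denseTime t i))
          (x (firstChange x (denseTime t i))) else 0 := by
  rw [show ∑' s : {s : ℝ≥0 // t ≤ s ∧ IsJumpTime x s}, F s (Function.leftLim x s) (x s) = _ from
      tsum_subtype {s | t ≤ s ∧ IsJumpTime x s} (fun s => F s (Function.leftLim x s) (x s)),
    tsum_eq_tsum_first_occurrence _ (fun i => firstChange x (denseTime t i))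
      (fun i => ChangesAfter x (denseTime t i))]
  · refine tsum_congr fun i => ?_
    split_ifs with hi
    · have hj := isJumpTime_firstChange hx hi.1
      have hmem : firstChange x (denseTime t i) ∈ {s | t ≤ s ∧ IsJumpTime x s} :=
        ⟨(le_denseTime t i).trans (le_firstChange hi.1), hj.2⟩
      rw [indicator_of_mem hmem, hj.1]
    · rfl
  · intro s hs
    obtain ⟨hts, hj⟩ := mem_of_indicator_ne_zero hs
    obtain ⟨p, hp, hconst⟩ := hj.exists_left hx
    have hlt : t < s := hts.lt_of_ne (by rintro rfl; exact ht hj)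
    obtain ⟨i, hi, his⟩ := exists_denseTime (le_max_left t p) (max_lt hlt hp)
    have hpi := (le_max_right t p).trans_lt hi
    have hne : x s ≠ x (denseTime t i) := by
      rw [hconst _ hpi his]
      exact hj.symm
    exact ⟨i, ⟨s, his.le, hne⟩, firstChange_eq his hne fun w h1 h2 => by
      rw [hconst w (hpi.trans_le h1) h2, hconst _ hpi his]⟩

open scoped Classical in
lemma tsum_states_eq_enum {S : Type*} {x : ℝ≥0 → S} (hx : IsPiecewiseConstantPath x) (t : ℝ≥0)
    (F : S → ℝ) (hF : ∀ g, (∀ s, t ≤ s → x s ≠ g) → F g = 0) :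
    ∑' g, F g = ∑' i, if ∀ j < i, x (denseTime t j) ≠ x (denseTime t i)
      then F (x (denseTime t i)) else 0 := by
  rw [tsum_eq_tsum_first_occurrence _ (fun i => x (denseTime t i)) (fun _ => True)]
  · simp
  · intro g hg
    by_contra hcon
    refine hg (hF g ?_)
    rintro s hts rfl
    obtain ⟨u, hu, hconst⟩ := hx.exists_right s
    obtain ⟨i, hi, hiu⟩ := exists_denseTime hts hu
    exact hcon ⟨i, trivial, hconst _ hi.le hiu⟩

/-! ### Measurability for right continuous processes -/

/-- The point with index `k + 1` of the grid with mesh `1 / (n + 1)`. -/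
def gridPoint (n k : ℕ) : ℝ≥0 := ((k : ℝ≥0) + 1) / (n + 1)

/-- The first point strictly after `s` of the grid with mesh `1 / (n + 1)`. -/
def gridSucc (n : ℕ) (s : ℝ≥0) : ℝ≥0 := gridPoint n ⌊s * (n + 1)⌋₊

lemma lt_gridSucc (n : ℕ) (s : ℝ≥0) : s < gridSucc n s := by
  rw [gridSucc, gridPoint, lt_div_iff₀ (by positivity)]
  exact Nat.lt_floor_add_one _

lemma gridSucc_le (n : ℕ) (s : ℝ≥0) : gridSucc n s ≤ s + 1 / (n + 1) := by
  rw [gridSucc, gridPoint, div_le_iff₀ (by positivity), add_mul, one_div_mul_cancel (by positivity)]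
  gcongr
  exact Nat.floor_le zero_le

lemma tendsto_gridSucc (s : ℝ≥0) : Tendsto (fun n => gridSucc n s) atTop (𝓝[>] s) := by
  refine tendsto_nhdsWithin_of_tendsto_nhds_of_eventually_within _ ?_
    (Eventually.of_forall fun n => lt_gridSucc n s)
  refine tendsto_of_tendsto_of_tendsto_of_le_of_le tendsto_const_nhds ?_
    (fun n => (lt_gridSucc n s).le) (fun n => gridSucc_le n s)
  simpa using tendsto_const_nhds.add (tendsto_one_div_add_atTop_nhds_zero_nat (𝕜 := ℝ≥0))

lemma measurable_floor_grid (n : ℕ) : Measurable fun s : ℝ≥0 => ⌊s * (n + 1)⌋₊ :=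
  Nat.measurable_floor.comp (measurable_id.mul_const _)

lemma measurable_gridSucc (n : ℕ) : Measurable (gridSucc n) :=
  (measurable_from_top (f := gridPoint n)).comp (measurable_floor_grid n)

/-- A right continuous path that avoids a state at one time avoids it at a time of the dense
sequence shortly afterwards. -/
lemma exists_denseTime_ne {S : Type*} [TopologicalSpace S] [T1Space S] {x : ℝ≥0 → S}
    (hr : ∀ t, ContinuousWithinAt x (Ici t) t) {t q s u : ℝ≥0}
    (htq : t ≤ q) (hqs : q ≤ s) (hsu : s < u) {y : S} (hne : x s ≠ y) :
    ∃ i, q ≤ denseTime t i ∧ denseTime t i < u ∧ x (denseTime t i) ≠ y := by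
  have h1 : ∀ᶠ w in 𝓝[≥] s, x w ≠ y := (hr s).eventually_ne hne
  obtain ⟨v, hv, hsub⟩ := mem_nhdsGE_iff_exists_Ico_subset.1 h1
  obtain ⟨i, hi, hiv⟩ := exists_denseTime (htq.trans hqs) (lt_min hv hsu)
  exact ⟨i, hqs.trans hi.le, hiv.trans_le (min_le_right _ _),
    hsub ⟨hi.le, hiv.trans_le (min_le_left _ _)⟩⟩

section Processes

variable {S : Type*} [TopologicalSpace S] [PolishSpace S] [MeasurableSpace S] [BorelSpace S]
  {Ω : Type*} [MeasurableSpace Ω] {Y : ℝ≥0 → Ω → S}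

/-- A right continuous process is the limit of its values at the next grid point, which depend on
time through a countable index only. -/
lemma measurable_uncurry_of_rightContinuous (hY : ∀ s, Measurable (Y s))
    (hr : ∀ ω t, ContinuousWithinAt (fun s => Y s ω) (Ici t) t) :
    Measurable (Function.uncurry Y) := by
  have happrox : ∀ n : ℕ, Measurable fun p : ℝ≥0 × Ω => Y (gridSucc n p.1) p.2 := by
    intro n
    have h : Measurable fun p : ℕ × Ω => Y (gridPoint n p.1) p.2 :=
      measurable_from_prod_countable_right fun k => hY (gridPoint n k)
    have h2 : Measurable fun p : ℝ≥0 × Ω => (⌊p.1 * (n + 1)⌋₊, p.2) :=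
      ((measurable_floor_grid n).comp measurable_fst).prodMk measurable_snd
    have h3 := h.comp h2
    simp only [Function.comp_def] at h3
    simpa only [gridSucc] using h3
  let _ := TopologicalSpace.upgradeIsCompletelyMetrizable S
  refine measurable_of_tendsto_metrizable happrox ?_
  rw [tendsto_pi_nhds]
  rintro ⟨s, ω⟩
  exact (hr ω s).tendsto.comp
    ((tendsto_gridSucc s).mono_right (nhdsWithin_mono _ Ioi_subset_Ici_self))

lemma measurableSet_changesAfter (hY : ∀ s, Measurable (Y s))
    (hr : ∀ ω t, ContinuousWithinAt (fun s => Y s ω) (Ici t) t) (q : ℝ≥0) :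
    MeasurableSet {ω | ChangesAfter (fun s => Y s ω) q} := by
  have : {ω | ChangesAfter (fun s => Y s ω) q} = ⋃ i, {ω | Y (denseTime q i) ω ≠ Y q ω} := by
    ext ω
    simp only [mem_ofPred_eq, mem_iUnion]
    constructor
    · rintro ⟨s, hqs, hs⟩
      obtain ⟨i, -, -, hi⟩ := exists_denseTime_ne (hr ω) le_rfl hqs (lt_add_one s) hs
      exact ⟨i, hi⟩
    · rintro ⟨i, hi⟩
      exact ⟨_, le_denseTime q i, hi⟩
  rw [this]
  exact MeasurableSet.iUnion fun i => (measurableSet_eq_fun (hY _) (hY _)).compl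

lemma measurable_firstChange (hY : ∀ s, Measurable (Y s))
    (hr : ∀ ω t, ContinuousWithinAt (fun s => Y s ω) (Ici t) t) (q : ℝ≥0) :
    Measurable fun ω => firstChange (fun s => Y s ω) q := by
  refine measurable_of_Iio fun u => ?_
  have : (fun ω => firstChange (fun s => Y s ω) q) ⁻¹' Iio u =
      ({ω | ChangesAfter (fun s => Y s ω) q}ᶜ ∩ {_ω | 0 < u}) ∪
        ⋃ i, {ω | denseTime q i < u ∧ Y (denseTime q i) ω ≠ Y q ω} := by
    ext ω
    simp only [mem_preimage, mem_Iio, mem_union, mem_inter_iff, mem_compl_iff, mem_ofPred_eq,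
      mem_iUnion]
    by_cases hc : ChangesAfter (fun s => Y s ω) q
    · simp only [hc, not_true_eq_false, false_and, false_or]
      rw [show firstChange (fun s => Y s ω) q < u ↔ _ from
        csInf_lt_iff (OrderBot.bddBelow _) hc]
      constructor
      · rintro ⟨s, ⟨hqs, hs⟩, hsu⟩
        obtain ⟨i, -, h1, h2⟩ := exists_denseTime_ne (hr ω) le_rfl hqs hsu hs
        exact ⟨i, h1, h2⟩
      · rintro ⟨i, h1, h2⟩
        exact ⟨_, ⟨le_denseTime q i, h2⟩, h1⟩
    · have h0 : firstChange (fun s => Y s ω) q = 0 := by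
        have : {s | q ≤ s ∧ Y s ω ≠ Y q ω} = ∅ := by
          by_contra hne
          exact hc (nonempty_iff_ne_empty.2 hne)
        rw [firstChange, this]
        exact NNReal.sInf_empty
      rw [h0]
      simp only [hc, not_false_eq_true, true_and]
      refine ⟨Or.inl, ?_⟩
      rintro (h | ⟨i, -, h⟩)
      · exact h
      · exact absurd ⟨_, le_denseTime q i, h⟩ hc
  rw [this]
  refine ((measurableSet_changesAfter hY hr q).compl.inter (MeasurableSet.const _)).union
    (MeasurableSet.iUnion fun i => ?_)
  exact (MeasurableSet.const _).inter (measurableSet_eq_fun (hY _) (hY _)).compl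

lemma measurable_apply_of_rightContinuous (hY : ∀ s, Measurable (Y s))
    (hr : ∀ ω t, ContinuousWithinAt (fun s => Y s ω) (Ici t) t) {τ : Ω → ℝ≥0}
    (hτ : Measurable τ) : Measurable fun ω => Y (τ ω) ω :=
  (measurable_uncurry_of_rightContinuous hY hr).comp (hτ.prodMk measurable_id)

/-- Constancy of a right continuous process on a random interval `[τ, u]` is a measurable event. -/
lemma measurableSet_const_after (hY : ∀ s, Measurable (Y s))
    (hr : ∀ ω t, ContinuousWithinAt (fun s => Y s ω) (Ici t) t) {τ : Ω → ℝ≥0}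
    (hτ : Measurable τ) (u : ℝ≥0) :
    MeasurableSet {ω | ∀ s, τ ω ≤ s → s ≤ u → Y s ω = Y (τ ω) ω} := by
  have hYτ := measurable_apply_of_rightContinuous hY hr hτ
  have : {ω | ∀ s, τ ω ≤ s → s ≤ u → Y s ω = Y (τ ω) ω} =
      {ω | τ ω ≤ u → Y u ω = Y (τ ω) ω} ∩
        ⋂ i, {ω | τ ω ≤ denseTime 0 i → denseTime 0 i ≤ u →
          Y (denseTime 0 i) ω = Y (τ ω) ω} := by
    ext ω
    simp only [mem_ofPred_eq, mem_inter_iff, mem_iInter]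
    refine ⟨fun h => ⟨fun hu => h u hu le_rfl, fun i h1 h2 => h _ h1 h2⟩,
      fun ⟨h1, h2⟩ s hs hsu => ?_⟩
    rcases hsu.eq_or_lt with rfl | hlt
    · exact h1 hs
    · by_contra hne
      obtain ⟨i, hi, hiu, hine⟩ := exists_denseTime_ne (hr ω) zero_le hs hlt hne
      exact hine (h2 i hi hiu.le)
  rw [this]
  refine MeasurableSet.inter ?_ (MeasurableSet.iInter fun i => ?_)
  · exact (measurableSet_le hτ measurable_const).imp (measurableSet_eq_fun (hY _) hYτ)
  · exact (measurableSet_le hτ measurable_const).imp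
      ((MeasurableSet.const _).imp (measurableSet_eq_fun (hY _) hYτ))

end Processes

/-! ### The present value as a functional of the path -/

lemma tsum_jumps_eq_indicator {S α : Type*} [TopologicalSpace S] [AddCommMonoid α]
    [TopologicalSpace α] (t : ℝ≥0) (x : ℝ≥0 → S) (f : ℝ≥0 → α) :
    ∑' s : {s : ℝ≥0 // t ≤ s ∧ IsJumpTime x s}, f s =
      ∑' s, {s | t ≤ s ∧ IsJumpTime x s}.indicator f s :=
  tsum_subtype {s | t ≤ s ∧ IsJumpTime x s} f

namespace RegularInsuranceModel

variable {S : Type*} [TopologicalSpace S] [PolishSpace S] [MeasurableSpace S] [BorelSpace S]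
  {Ω : Type*} [MeasurableSpace Ω] (M : RegularInsuranceModel S Ω) (r : ℝ≥0 → ℝ)

lemma measurable_B_left (t : ℝ≥0) : Measurable (M.B t) := M.measurable_B.of_uncurry_left

/-- The positive parts of the payment measures `dB_g`, as a kernel in `g`. -/
def posKernel : Kernel S ℝ≥0 :=
  ⟨fun g => stieltjesPos fun s => M.B s g,
    measurable_stieltjesPos M.measurable_B_left M.locallyBoundedVariationOn_B⟩

/-- The negative parts of the payment measures `dB_g`, as a kernel in `g`. -/
def negKernel : Kernel S ℝ≥0 :=
  ⟨fun g => stieltjesNeg fun s => M.B s g,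
    measurable_stieltjesNeg M.measurable_B_left M.locallyBoundedVariationOn_B⟩

instance : IsSFiniteKernel M.posKernel :=
  isSFiniteKernel_of_isLocallyFiniteMeasure _ fun g =>
    inferInstanceAs (IsLocallyFiniteMeasure (stieltjesPos fun s => M.B s g))

instance : IsSFiniteKernel M.negKernel :=
  isSFiniteKernel_of_isLocallyFiniteMeasure _ fun g =>
    inferInstanceAs (IsLocallyFiniteMeasure (stieltjesNeg fun s => M.B s g))

/-- Joint measurability of Lebesgue–Stieltjes integrals `∫_A φ dB_γ` in integrand, domain and
state. -/
lemma measurable_stieltjesIntegral {ι : Type*} [MeasurableSpace ι] {γ : ι → S} (hγ : Measurable γ)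
    {A : ι → Set ℝ≥0} (hA : MeasurableSet {p : ι × ℝ≥0 | p.2 ∈ A p.1}) {φ : ι → ℝ≥0 → ℝ}
    (hφ : Measurable (Function.uncurry φ)) :
    Measurable fun i => stieltjesIntegral (fun s => M.B s (γ i)) (A i) (φ i) := by
  have hAi : ∀ i, MeasurableSet (A i) := fun i => measurable_prodMk_left hA
  have hf : StronglyMeasurable
      ({p : ι × ℝ≥0 | p.2 ∈ A p.1}.indicator (Function.uncurry φ)) :=
    (hφ.indicator hA).stronglyMeasurable
  have hp := hf.integral_kernel_prod_right' (κ := M.posKernel.comap γ hγ)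
  have hn := hf.integral_kernel_prod_right' (κ := M.negKernel.comap γ hγ)
  have heq : (fun i => stieltjesIntegral (fun s => M.B s (γ i)) (A i) (φ i)) = fun i =>
      (∫ s, {p : ι × ℝ≥0 | p.2 ∈ A p.1}.indicator (Function.uncurry φ) (i, s)
          ∂(M.posKernel.comap γ hγ i)) -
        ∫ s, {p : ι × ℝ≥0 | p.2 ∈ A p.1}.indicator (Function.uncurry φ) (i, s)
          ∂(M.negKernel.comap γ hγ i) := by
    ext i
    rw [stieltjesIntegral, ← integral_indicator (hAi i), ← integral_indicator (hAi i)]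
    rfl
  rw [heq]
  exact (hp.sub hn).measurable

open scoped Classical in
/-- The present value at time `t` along a path, with the states and the jump times enumerated by
means of a dense sequence of times. Unlike the sums over all states and over all jump times that it
replaces, it is measurable in the path for trivial reasons. -/
def enumeratedValue (t : ℝ≥0) (x : ℝ≥0 → S) : ℝ :=
  (∑' i, if ∀ j < i, x (denseTime t j) ≠ x (denseTime t i)
    then stieltjesIntegral (fun s => M.B s (x (denseTime t i)))
      {s | t ≤ s ∧ x s = x (denseTime t i)} (discount r t) else 0) +
  ∑' i, if ChangesAfter x (denseTime t i) ∧ ∀ j < i, ChangesAfter x (denseTime t j) →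
      firstChange x (denseTime t j) ≠ firstChange x (denseTime t i)
    then discount r t (firstChange x (denseTime t i)) *
      M.b (firstChange x (denseTime t i)) (x (denseTime t i))
        (x (firstChange x (denseTime t i))) else 0

lemma sojournValue_add_transitionValue_eq {t : ℝ≥0} {x : ℝ≥0 → S}
    (hx : IsPiecewiseConstantPath x) (ht : ¬ IsJumpTime x t) :
    M.sojournValue r t x + M.transitionValue r t x = M.enumeratedValue r t x := by
  rw [sojournValue, transitionValue, enumeratedValue,
    tsum_jumps_eq_enum hx ht (fun s g h => discount r t s * M.b s g h),
    tsum_states_eq_enum hx t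
      (fun g => stieltjesIntegral (fun s => M.B s g) {s | t ≤ s ∧ x s = g} (discount r t))]
  intro g hg
  have : {s | t ≤ s ∧ x s = g} = ∅ := by
    ext s
    simp only [mem_ofPred_eq, mem_empty_iff_false, iff_false, not_and]
    exact hg s
  simp [this, stieltjesIntegral]

lemma enumeratedValue_congr {t : ℝ≥0} {x y : ℝ≥0 → S} (h : ∀ s, t ≤ s → x s = y s) :
    M.enumeratedValue r t x = M.enumeratedValue r t y := by
  classical
  have h1 : ∀ i, x (denseTime t i) = y (denseTime t i) := fun i => h _ (le_denseTime t i)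
  have hset : ∀ i, {s | denseTime t i ≤ s ∧ x s ≠ x (denseTime t i)} =
      {s | denseTime t i ≤ s ∧ y s ≠ y (denseTime t i)} := by
    intro i
    ext s
    simp only [mem_ofPred_eq]
    refine and_congr_right fun hs => ?_
    rw [h s ((le_denseTime t i).trans hs), h1 i]
  have h2 : ∀ i, ChangesAfter x (denseTime t i) ↔ ChangesAfter y (denseTime t i) := fun i =>
    (congrArg Set.Nonempty (hset i)).to_iff
  have h3 : ∀ i, firstChange x (denseTime t i) = firstChange y (denseTime t i) := fun i =>
    congrArg sInf (hset i)
  have h4 : ∀ i, {s | t ≤ s ∧ x s = x (denseTime t i)} = {s | t ≤ s ∧ y s = y (denseTime t i)} := by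
    intro i
    ext s
    simp only [mem_ofPred_eq]
    refine and_congr_right fun hs => ?_
    rw [h s hs, h1 i]
  have hif : ∀ {p q : Prop} [Decidable p] [Decidable q] {u v : ℝ}, (p ↔ q) → (q → u = v) →
      (if p then u else 0) = if q then v else 0 := by
    intro p q _ _ u v hpq huv
    by_cases hq : q
    · rw [if_pos (hpq.2 hq), if_pos hq, huv hq]
    · rw [if_neg (hpq.not.2 hq), if_neg hq]
  rw [enumeratedValue, enumeratedValue]
  congr 1
  · refine tsum_congr fun i => hif (by simp only [h1]) fun _ => by rw [h4, h1]
  · refine tsum_congr fun i => hif (by simp only [h2, h3]) fun hc => ?_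
    rw [h3, h1, h _ ((le_denseTime t i).trans (le_firstChange hc.1))]

lemma measurable_enumeratedValue {Ω' : Type*} [MeasurableSpace Ω'] {Y : ℝ≥0 → Ω' → S}
    (hr : LocallyIntegrable r timeMeasure) (hY : ∀ s, Measurable (Y s))
    (hrc : ∀ ω t, ContinuousWithinAt (fun s => Y s ω) (Ici t) t) (t : ℝ≥0) :
    Measurable fun ω => M.enumeratedValue r t fun s => Y s ω := by
  classical
  have hjoint := measurable_uncurry_of_rightContinuous hY hrc
  have hdisc : Measurable (discount r t) := (continuous_discount hr t).measurable
  refine Measurable.add (Measurable.tsum fun i => ?_) (Measurable.tsum fun i => ?_)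
  · refine Measurable.ite ?_ ?_ measurable_const
    · rw [show {ω | ∀ j < i, Y (denseTime t j) ω ≠ Y (denseTime t i) ω} =
        ⋂ j, ⋂ (_ : j < i), {ω | Y (denseTime t j) ω ≠ Y (denseTime t i) ω} by ext; simp]
      exact MeasurableSet.iInter fun j => MeasurableSet.iInter fun _ =>
        (measurableSet_eq_fun (hY _) (hY _)).compl
    · refine M.measurable_stieltjesIntegral (hY _) (φ := fun _ => discount r t) ?_
        (hdisc.comp measurable_snd)
      refine (measurableSet_le measurable_const measurable_snd).inter (measurableSet_eq_fun ?_ ?_)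
      · exact hjoint.comp measurable_swap
      · exact (hY _).comp measurable_fst
  · have hfc : ∀ i, Measurable fun ω => firstChange (fun s => Y s ω) (denseTime t i) := fun i =>
      measurable_firstChange hY hrc _
    refine Measurable.ite ?_ ?_ measurable_const
    · refine (measurableSet_changesAfter hY hrc _).inter (s₂ := {ω | ∀ j < i,
        ChangesAfter (fun s => Y s ω) (denseTime t j) →
        firstChange (fun s => Y s ω) (denseTime t j) ≠
          firstChange (fun s => Y s ω) (denseTime t i)}) ?_
      rw [show {ω | ∀ j < i, ChangesAfter (fun s => Y s ω) (denseTime t j) →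
          firstChange (fun s => Y s ω) (denseTime t j) ≠
            firstChange (fun s => Y s ω) (denseTime t i)} =
        ⋂ j, ⋂ (_ : j < i), {ω | ChangesAfter (fun s => Y s ω) (denseTime t j) →
          firstChange (fun s => Y s ω) (denseTime t j) ≠
            firstChange (fun s => Y s ω) (denseTime t i)} by ext; simp]
      exact MeasurableSet.iInter fun j => MeasurableSet.iInter fun _ =>
        (measurableSet_changesAfter hY hrc _).imp (measurableSet_eq_fun (hfc _) (hfc _)).compl
    · refine (hdisc.comp (hfc i)).mul ?_
      exact M.measurable_b.comp ((hfc i).prodMk ((hY _).prodMk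
        (measurable_apply_of_rightContinuous hY hrc (hfc i))))

/-! ### Splitting the present value at a later time -/

/-- The discounted sojourn payments `∫_{[a, w)} v(a, s) dB_g(s)` for a stay in `g`. -/
def stayValue (a w : ℝ≥0) (g : S) : ℝ :=
  stieltjesIntegral (fun s => M.B s g) (Ico a w) (discount r a)

variable {r}

lemma measurable_path (ω : Ω) : Measurable fun s => M.X s ω := by
  have h : ∀ s, Measurable (M.X s) := fun s => (M.measurable_X s).mono (M.𝓕.le s) le_rfl
  exact (measurable_uncurry_of_rightContinuous h fun ω t => (M.cadlag ω t).1).comp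
    measurable_prodMk_right

lemma measurableSet_stay (t : ℝ≥0) (g : S) (ω : Ω) : MeasurableSet {s | t ≤ s ∧ M.X s ω = g} :=
  measurableSet_Ici.inter (M.measurable_path ω (measurableSet_singleton g))

lemma stieltjesIntegral_smul_congr {f : ℝ≥0 → ℝ} {A : Set ℝ≥0} (hA : MeasurableSet A)
    {φ ψ : ℝ≥0 → ℝ} {k : ℝ} (h : ∀ s ∈ A, φ s = k * ψ s) :
    stieltjesIntegral f A φ = k * stieltjesIntegral f A ψ := by
  rw [stieltjesIntegral, stieltjesIntegral, setIntegral_congr_fun hA h, setIntegral_congr_fun hA h,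
    integral_const_mul, integral_const_mul, mul_sub]

lemma stieltjesIntegral_union {f : ℝ≥0 → ℝ} {A A' : Set ℝ≥0} (hd : Disjoint A A')
    (hA' : MeasurableSet A') {φ : ℝ≥0 → ℝ}
    (hp : IntegrableOn φ (A ∪ A') (stieltjesPos f))
    (hn : IntegrableOn φ (A ∪ A') (stieltjesNeg f)) :
    stieltjesIntegral f (A ∪ A') φ = stieltjesIntegral f A φ + stieltjesIntegral f A' φ := by
  rw [stieltjesIntegral, stieltjesIntegral, stieltjesIntegral,
    setIntegral_union hd hA' (hp.mono_set subset_union_left) (hp.mono_set subset_union_right),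
    setIntegral_union hd hA' (hn.mono_set subset_union_left) (hn.mono_set subset_union_right)]
  ring

lemma integrableOn_of_lintegral_stieltjesVar {f : ℝ≥0 → ℝ} {A : Set ℝ≥0} {φ : ℝ≥0 → ℝ}
    (hφ : Measurable φ) (h0 : ∀ s, 0 ≤ φ s)
    (h : ∫⁻ s in A, ENNReal.ofReal (φ s) ∂stieltjesVar f < ∞) :
    IntegrableOn φ A (stieltjesPos f) ∧ IntegrableOn φ A (stieltjesNeg f) := by
  have hI : Integrable φ ((stieltjesVar f).restrict A) := by
    refine ⟨hφ.aestronglyMeasurable, ?_⟩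
    rw [hasFiniteIntegral_iff_ofReal (Eventually.of_forall h0)]
    exact h
  rw [stieltjesVar, Measure.restrict_add] at hI
  exact ⟨hI.left_of_add_measure, hI.right_of_add_measure⟩

lemma abs_stieltjesIntegral_le {f : ℝ≥0 → ℝ} {A : Set ℝ≥0} {φ : ℝ≥0 → ℝ}
    (hφ : Measurable φ) (h0 : ∀ s, 0 ≤ φ s)
    (h : ∫⁻ s in A, ENNReal.ofReal (φ s) ∂stieltjesVar f < ∞) :
    |stieltjesIntegral f A φ| ≤ (∫⁻ s in A, ENNReal.ofReal (φ s) ∂stieltjesVar f).toReal := by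
  have hint := integrableOn_of_lintegral_stieltjesVar hφ h0 h
  have h1 : ∫⁻ s in A, ENNReal.ofReal (φ s) ∂stieltjesVar f =
      ENNReal.ofReal (∫ s in A, φ s ∂stieltjesPos f) +
        ENNReal.ofReal (∫ s in A, φ s ∂stieltjesNeg f) := by
    rw [stieltjesVar, Measure.restrict_add, lintegral_add_measure,
      ofReal_integral_eq_lintegral_ofReal hint.1 (Eventually.of_forall h0),
      ofReal_integral_eq_lintegral_ofReal hint.2 (Eventually.of_forall h0)]
  have hp : 0 ≤ ∫ s in A, φ s ∂stieltjesPos f := integral_nonneg h0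
  have hn : 0 ≤ ∫ s in A, φ s ∂stieltjesNeg f := integral_nonneg h0
  rw [h1, ← ENNReal.ofReal_add hp hn, ENNReal.toReal_ofReal (add_nonneg hp hn), stieltjesIntegral,
    abs_le]
  constructor <;> linarith

lemma ofReal_discount_mul (hr : LocallyIntegrable r timeMeasure) {a w s : ℝ≥0} (haw : a ≤ w)
    (hws : w ≤ s) :
    ENNReal.ofReal (discount r w s) =
      ENNReal.ofReal (discount r a w)⁻¹ * ENNReal.ofReal (discount r a s) := by
  rw [← ENNReal.ofReal_mul (inv_nonneg.2 (discount_pos r a w).le),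
    ← discount_mul_discount hr haw hws, inv_mul_cancel_left₀ (discount_pos r a w).ne']

lemma presentVariation_lt_top_of_le (hr : LocallyIntegrable r timeMeasure) {a w : ℝ≥0} {ω : Ω}
    (haw : a ≤ w) (h : M.presentVariation r a ω < ∞) : M.presentVariation r w ω < ∞ := by
  rw [presentVariation, ENNReal.add_lt_top] at h ⊢
  set k := ENNReal.ofReal (discount r a w)⁻¹
  constructor
  · refine lt_of_le_of_lt ?_ (ENNReal.mul_lt_top (ENNReal.ofReal_lt_top (r := (discount r a w)⁻¹))
      h.1)
    rw [← ENNReal.tsum_mul_left]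
    refine ENNReal.tsum_le_tsum fun g => ?_
    rw [← lintegral_const_mul _ (continuous_discount hr a).measurable.ennreal_ofReal]
    refine le_trans (le_of_eq (setLIntegral_congr_fun (M.measurableSet_stay w g ω) fun s hs =>
      ofReal_discount_mul hr haw hs.1)) (lintegral_mono_set fun s hs => ⟨haw.trans hs.1, hs.2⟩)
  · refine lt_of_le_of_lt ?_ (ENNReal.mul_lt_top (ENNReal.ofReal_lt_top (r := (discount r a w)⁻¹))
      h.2)
    rw [← ENNReal.tsum_mul_left]
    rw [tsum_jumps_eq_indicator w (fun w => M.X w ω) fun s => ENNReal.ofReal (discount r w s *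
        |M.b s (Function.leftLim (fun w => M.X w ω) s) (M.X s ω)|),
      tsum_jumps_eq_indicator a (fun w => M.X w ω) fun s => ENNReal.ofReal (discount r a w)⁻¹ *
        ENNReal.ofReal (discount r a s *
        |M.b s (Function.leftLim (fun w => M.X w ω) s) (M.X s ω)|)]
    refine ENNReal.tsum_le_tsum fun s => ?_
    by_cases hs : w ≤ s ∧ IsJumpTime (fun w => M.X w ω) s
    · rw [indicator_of_mem (show s ∈ {s | w ≤ s ∧ IsJumpTime (fun w => M.X w ω) s} from hs),
        indicator_of_mem (show s ∈ {s | a ≤ s ∧ IsJumpTime (fun w => M.X w ω) s} from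
          ⟨haw.trans hs.1, hs.2⟩), ENNReal.ofReal_mul (discount_pos r w s).le,
        ENNReal.ofReal_mul (discount_pos r a s).le, ofReal_discount_mul hr haw hs.1, mul_assoc]
    · rw [indicator_of_notMem (show s ∉ {s | w ≤ s ∧ IsJumpTime (fun w => M.X w ω) s} from hs)]
      exact zero_le

lemma sojournValue_split (hr : LocallyIntegrable r timeMeasure) {a w : ℝ≥0} {ω : Ω} {g : S}
    (haw : a ≤ w) (hg : ∀ s, a ≤ s → s < w → M.X s ω = g) (h : M.presentVariation r a ω < ∞) :
    M.sojournValue r a (fun s => M.X s ω) =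
      M.stayValue r a w g + discount r a w * M.sojournValue r w (fun s => M.X s ω) := by
  rw [presentVariation, ENNReal.add_lt_top] at h
  have hdm : Measurable (discount r a) := (continuous_discount hr a).measurable
  have hd0 : ∀ s, 0 ≤ discount r a s := fun s => (discount_pos r a s).le
  have hset : ∀ g', {s | a ≤ s ∧ M.X s ω = g'} =
      {s | (a ≤ s ∧ s < w) ∧ M.X s ω = g'} ∪ {s | w ≤ s ∧ M.X s ω = g'} := by
    intro g'
    ext s
    simp only [mem_ofPred_eq, mem_union]
    constructor
    · rintro ⟨h1, h2⟩
      rcases lt_or_ge s w with h3 | h3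
      · exact Or.inl ⟨⟨h1, h3⟩, h2⟩
      · exact Or.inr ⟨h3, h2⟩
    · rintro (⟨⟨h1, -⟩, h2⟩ | ⟨h1, h2⟩)
      · exact ⟨h1, h2⟩
      · exact ⟨haw.trans h1, h2⟩
  have hdisj : ∀ g', Disjoint {s | (a ≤ s ∧ s < w) ∧ M.X s ω = g'}
      {s | w ≤ s ∧ M.X s ω = g'} := fun g' =>
    disjoint_left.2 fun s h1 h2 => (not_le.2 h1.1.2) h2.1
  have hlt : ∀ g', ∫⁻ s in {s | a ≤ s ∧ M.X s ω = g'},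
      ENNReal.ofReal (discount r a s) ∂stieltjesVar (fun s => M.B s g') < ∞ := fun g' =>
    lt_of_le_of_lt (ENNReal.le_tsum g') h.1
  have hle : ∀ g', ∫⁻ s in {s | w ≤ s ∧ M.X s ω = g'},
      ENNReal.ofReal (discount r a s) ∂stieltjesVar (fun s => M.B s g') ≤
      ∫⁻ s in {s | a ≤ s ∧ M.X s ω = g'},
      ENNReal.ofReal (discount r a s) ∂stieltjesVar (fun s => M.B s g') := fun g' =>
    lintegral_mono_set fun s hs => ⟨haw.trans hs.1, hs.2⟩
  have hsplit : ∀ g', stieltjesIntegral (fun s => M.B s g') {s | a ≤ s ∧ M.X s ω = g'}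
        (discount r a) =
      stieltjesIntegral (fun s => M.B s g') {s | (a ≤ s ∧ s < w) ∧ M.X s ω = g'} (discount r a) +
      stieltjesIntegral (fun s => M.B s g') {s | w ≤ s ∧ M.X s ω = g'} (discount r a) := by
    intro g'
    have hint := integrableOn_of_lintegral_stieltjesVar hdm hd0 (hlt g')
    rw [hset g'] at hint ⊢
    exact stieltjesIntegral_union (hdisj g') (M.measurableSet_stay w g' ω) hint.1 hint.2
  have hfirst : ∀ g', g' ≠ g → stieltjesIntegral (fun s => M.B s g')
      {s | (a ≤ s ∧ s < w) ∧ M.X s ω = g'} (discount r a) = 0 := by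
    intro g' hne
    have : {s | (a ≤ s ∧ s < w) ∧ M.X s ω = g'} = ∅ := by
      ext s
      simp only [mem_ofPred_eq, mem_empty_iff_false, iff_false]
      rintro ⟨⟨h1, h2⟩, h3⟩
      exact hne (h3.symm.trans (hg s h1 h2))
    simp [this, stieltjesIntegral]
  have hfirst' : {s | (a ≤ s ∧ s < w) ∧ M.X s ω = g} = Ico a w := by
    ext s
    simp only [mem_ofPred_eq, mem_Ico, and_iff_left_iff_imp]
    exact fun h1 => hg s h1.1 h1.2
  have hsum2 : Summable fun g' => stieltjesIntegral (fun s => M.B s g')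
      {s | w ≤ s ∧ M.X s ω = g'} (discount r a) := by
    refine Summable.of_norm_bounded (ENNReal.summable_toReal h.1.ne) fun g' => ?_
    exact (abs_stieltjesIntegral_le hdm hd0 ((hle g').trans_lt (hlt g'))).trans
      (ENNReal.toReal_mono (hlt g').ne (hle g'))
  have hsum1 : HasSum (fun g' => stieltjesIntegral (fun s => M.B s g')
      {s | (a ≤ s ∧ s < w) ∧ M.X s ω = g'} (discount r a)) (M.stayValue r a w g) := by
    have := hasSum_single g hfirst
    rwa [hfirst'] at this
  rw [sojournValue, tsum_congr hsplit, hsum1.summable.tsum_add hsum2, hsum1.tsum_eq, sojournValue,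
    ← tsum_mul_left]
  congr 1
  refine tsum_congr fun g' => ?_
  exact stieltjesIntegral_smul_congr (M.measurableSet_stay w g' ω) fun s hs =>
    (discount_mul_discount hr haw hs.1).symm

lemma transitionValue_split (hr : LocallyIntegrable r timeMeasure) {a w : ℝ≥0} {ω : Ω}
    (haw : a ≤ w) (h : M.presentVariation r a ω < ∞) :
    M.transitionValue r a (fun s => M.X s ω) =
      (∑' s, {s | (a ≤ s ∧ s < w) ∧ IsJumpTime (fun s => M.X s ω) s}.indicator
        (fun s => discount r a s * M.b s (Function.leftLim (fun s => M.X s ω) s) (M.X s ω)) s) +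
      discount r a w * M.transitionValue r w (fun s => M.X s ω) := by
  rw [presentVariation, ENNReal.add_lt_top] at h
  set f : ℝ≥0 → ℝ := fun s =>
    discount r a s * M.b s (Function.leftLim (fun s => M.X s ω) s) (M.X s ω) with hf
  have hV := h.2
  rw [tsum_jumps_eq_indicator a (fun w => M.X w ω) fun s => ENNReal.ofReal (discount r a s *
      |M.b s (Function.leftLim (fun w => M.X w ω) s) (M.X s ω)|)] at hV
  have hbound : Summable ({s | a ≤ s ∧ IsJumpTime (fun s => M.X s ω) s}.indicator f) := by
    refine Summable.of_norm_bounded (ENNReal.summable_toReal hV.ne) fun s => ?_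
    by_cases hs : s ∈ {s | a ≤ s ∧ IsJumpTime (fun s => M.X s ω) s}
    · rw [indicator_of_mem hs, indicator_of_mem hs, ENNReal.toReal_ofReal
        (mul_nonneg (discount_pos r a s).le (abs_nonneg _)), hf, Real.norm_eq_abs, abs_mul,
        abs_of_pos (discount_pos r a s)]
    · simp [indicator_of_notMem hs]
  have hset : {s | a ≤ s ∧ IsJumpTime (fun s => M.X s ω) s} =
      {s | (a ≤ s ∧ s < w) ∧ IsJumpTime (fun s => M.X s ω) s} ∪
        {s | w ≤ s ∧ IsJumpTime (fun s => M.X s ω) s} := by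
    ext s
    simp only [mem_ofPred_eq, mem_union]
    constructor
    · rintro ⟨h1, h2⟩
      rcases lt_or_ge s w with h3 | h3
      · exact Or.inl ⟨⟨h1, h3⟩, h2⟩
      · exact Or.inr ⟨h3, h2⟩
    · rintro (⟨⟨h1, -⟩, h2⟩ | ⟨h1, h2⟩)
      · exact ⟨h1, h2⟩
      · exact ⟨haw.trans h1, h2⟩
  have hdisj : Disjoint {s | (a ≤ s ∧ s < w) ∧ IsJumpTime (fun s => M.X s ω) s}
        {s | w ≤ s ∧ IsJumpTime (fun s => M.X s ω) s} :=
    disjoint_left.2 fun s h1 h2 => (not_le.2 h1.1.2) h2.1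
  have hs1 : Summable ({s | (a ≤ s ∧ s < w) ∧ IsJumpTime (fun s => M.X s ω) s}.indicator f) := by
    have hE : {s | (a ≤ s ∧ s < w) ∧ IsJumpTime (fun s => M.X s ω) s} =
        {s | s < w} ∩ {s | a ≤ s ∧ IsJumpTime (fun s => M.X s ω) s} :=
      Set.ext fun s => ⟨fun h => ⟨h.1.2, h.1.1, h.2⟩, fun h => ⟨⟨h.2.1, h.1⟩, h.2.2⟩⟩
    rw [hE, ← indicator_indicator]
    exact hbound.indicator _
  have hs2 : Summable ({s | w ≤ s ∧ IsJumpTime (fun s => M.X s ω) s}.indicator f) := by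
    have hE : {s | w ≤ s ∧ IsJumpTime (fun s => M.X s ω) s} =
        {s | w ≤ s} ∩ {s | a ≤ s ∧ IsJumpTime (fun s => M.X s ω) s} :=
      Set.ext fun s => ⟨fun h => ⟨h.1, haw.trans h.1, h.2⟩, fun h => ⟨h.1, h.2.2⟩⟩
    rw [hE, ← indicator_indicator]
    exact hbound.indicator _
  rw [transitionValue, transitionValue, tsum_jumps_eq_indicator a (fun s => M.X s ω) f, hset,
    indicator_union_of_disjoint hdisj, hs1.tsum_add hs2,
    tsum_jumps_eq_indicator w (fun s => M.X s ω)
      (fun s => discount r w s * M.b s (Function.leftLim (fun s => M.X s ω) s) (M.X s ω)),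
    ← tsum_mul_left]
  congr 1
  refine tsum_congr fun s => ?_
  by_cases hs : s ∈ {s | w ≤ s ∧ IsJumpTime (fun s => M.X s ω) s}
  · rw [indicator_of_mem hs, indicator_of_mem hs]
    simp only [hf]
    rw [← discount_mul_discount hr haw hs.1, mul_assoc]
  · rw [indicator_of_notMem hs, indicator_of_notMem hs, mul_zero]

lemma not_isJumpTime_of_stay {a w s : ℝ≥0} {ω : Ω} {g : S}
    (hg : ∀ s, a ≤ s → s < w → M.X s ω = g) (has : a < s) (hsw : s < w) :
    ¬ IsJumpTime (fun s => M.X s ω) s :=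
  not_isJumpTime_of_const has fun u h1 h2 =>
    (hg u h1.le (h2.trans_lt hsw)).trans (hg s has.le hsw).symm

/-- The present value at `a` if the state `g` is occupied on `[a, w)`. A jump at `a` is excluded,
since `V(a)` would contain the payment due to it. -/
lemma presentValue_split (hr : LocallyIntegrable r timeMeasure) {a w : ℝ≥0} {ω : Ω} {g : S}
    (haw : a ≤ w) (hg : ∀ s, a ≤ s → s < w → M.X s ω = g)
    (ha : ¬ IsJumpTime (fun s => M.X s ω) a) (h : M.presentVariation r a ω < ∞) :
    M.presentValue r a ω = M.stayValue r a w g + discount r a w * M.presentValue r w ω := by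
  have h0 : {s | (a ≤ s ∧ s < w) ∧ IsJumpTime (fun s => M.X s ω) s} = ∅ := by
    ext s
    simp only [mem_ofPred_eq, mem_empty_iff_false, iff_false]
    rintro ⟨⟨h1, h2⟩, h3⟩
    rcases h1.eq_or_lt with rfl | h1
    · exact ha h3
    · exact M.not_isJumpTime_of_stay hg h1 h2 h3
  rw [presentValue, presentValue, M.sojournValue_split hr haw hg h,
    M.transitionValue_split hr haw h, h0]
  simp only [indicator_empty, tsum_zero]
  ring

/-- The present value at a jump time `a` if the state reached is kept on `[a, w)`: it contains the
payment due to the jump. -/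
lemma presentValue_split_of_isJumpTime (hr : LocallyIntegrable r timeMeasure) {a w : ℝ≥0} {ω : Ω}
    {g : S} (haw : a < w) (hg : ∀ s, a ≤ s → s < w → M.X s ω = g)
    (ha : IsJumpTime (fun s => M.X s ω) a) (h : M.presentVariation r a ω < ∞) :
    M.presentValue r a ω = M.b a (Function.leftLim (fun s => M.X s ω) a) g +
      M.stayValue r a w g + discount r a w * M.presentValue r w ω := by
  have h0 : {s | (a ≤ s ∧ s < w) ∧ IsJumpTime (fun s => M.X s ω) s} = {a} := by
    ext s
    simp only [mem_ofPred_eq, mem_singleton_iff]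
    constructor
    · rintro ⟨⟨h1, h2⟩, h3⟩
      by_contra hne
      exact M.not_isJumpTime_of_stay hg (h1.lt_of_ne (Ne.symm hne)) h2 h3
    · rintro rfl
      exact ⟨⟨le_rfl, haw⟩, ha⟩
  rw [presentValue, presentValue, M.sojournValue_split hr haw.le hg h,
    M.transitionValue_split hr haw.le h, h0, tsum_eq_single a]
  · rw [indicator_of_mem (mem_singleton a), discount_self, hg a le_rfl haw]
    ring
  · exact fun s hs => indicator_of_notMem (s := {a}) hs _

end RegularInsuranceModel

/-! ### The Markov property for integrals -/

namespace RegularInsuranceModel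

variable {S : Type*} [TopologicalSpace S] [PolishSpace S] [MeasurableSpace S] [BorelSpace S]
  {Ω : Type*} [mΩ : MeasurableSpace Ω] (M : RegularInsuranceModel S Ω) (r : ℝ≥0 → ℝ)

instance (t : ℝ≥0) : IsMarkovKernel (M.ν t) := M.isMarkovKernel_ν t

/-- The `σ`-algebra generated by the process on `[a, u]`. -/
@[reducible]
def past (a u : ℝ≥0) : MeasurableSpace Ω :=
  ⨆ s ∈ Icc a u, MeasurableSpace.comap (M.X s) inferInstance

/-- The `σ`-algebra generated by the process on `[u, ∞)`. -/
@[reducible]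
def future (u : ℝ≥0) : MeasurableSpace Ω :=
  ⨆ s ∈ Ici u, MeasurableSpace.comap (M.X s) inferInstance

lemma measurable_state (s : ℝ≥0) : Measurable (M.X s) :=
  (M.measurable_X s).mono (M.𝓕.le s) le_rfl

lemma past_le (a u : ℝ≥0) : M.past a u ≤ mΩ :=
  iSup₂_le fun s _ => (M.measurable_state s).comap_le

lemma future_le (u : ℝ≥0) : M.future u ≤ mΩ :=
  iSup₂_le fun s _ => (M.measurable_state s).comap_le

lemma measurable_state_past {a u s : ℝ≥0} (hs : s ∈ Icc a u) : Measurable[M.past a u] (M.X s) :=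
  (comap_measurable (M.X s)).mono
    (le_iSup₂ (f := fun s (_ : s ∈ Icc a u) => MeasurableSpace.comap (M.X s) inferInstance) s hs)
    le_rfl

lemma measurable_state_future {u s : ℝ≥0} (hs : s ∈ Ici u) : Measurable[M.future u] (M.X s) :=
  (comap_measurable (M.X s)).mono
    (le_iSup₂ (f := fun s (_ : s ∈ Ici u) => MeasurableSpace.comap (M.X s) inferInstance) s hs)
    le_rfl

/-- Right continuity survives a continuous monotone change of time. -/
lemma continuousWithinAt_state_comp {θ : ℝ≥0 → ℝ≥0} (hθ : Continuous θ) (hm : Monotone θ) (ω : Ω)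
    (t : ℝ≥0) : ContinuousWithinAt (fun s => M.X (θ s) ω) (Ici t) t :=
  ((M.cadlag ω (θ t)).1).comp hθ.continuousWithinAt fun _ hs => hm hs

/-- The process started at time `a` and stopped at time `u`; its values are known at time `u`. -/
def stopped (a u s : ℝ≥0) (ω : Ω) : S := M.X (max a (min s u)) ω

lemma stopped_eq {a u s : ℝ≥0} (has : a ≤ s) (hsu : s ≤ u) (ω : Ω) :
    M.stopped a u s ω = M.X s ω := by
  rw [stopped, min_eq_left hsu, max_eq_right has]

lemma measurable_stopped {a u : ℝ≥0} (hau : a ≤ u) (s : ℝ≥0) :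
    Measurable[M.past a u] (M.stopped a u s) :=
  M.measurable_state_past ⟨le_max_left _ _, max_le hau (min_le_right _ _)⟩

lemma continuousWithinAt_stopped (a u : ℝ≥0) (ω : Ω) (t : ℝ≥0) :
    ContinuousWithinAt (fun s => M.stopped a u s ω) (Ici t) t :=
  M.continuousWithinAt_state_comp (θ := fun s => max a (min s u)) (by fun_prop)
    (fun _ _ h => max_le_max_left _ (min_le_min_right _ h)) ω t

variable {r}

/-- The Markov property, extended from events to functions of the future: on the `σ`-algebra of the
future, the law on `D` agrees with the mixture over `D` of the laws restarted at time `u`. -/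
theorem setIntegral_eq_of_markov {a u : ℝ≥0} (hau : a ≤ u) (g : S) {D : Set Ω}
    (hD : MeasurableSet[M.past a u] D) {φ : Ω → ℝ} (hφ : Measurable[M.future u] φ)
    (hint : IntegrableOn φ D (M.ν a g)) :
    ∫ ω in D, φ ω ∂(M.ν a g) = ∫ ω in D, (∫ ω', φ ω' ∂(M.ν u (M.X u ω))) ∂(M.ν a g) := by
  set μ := (M.ν a g).restrict D with hμ
  set κ : Kernel Ω Ω := (M.ν u).comap (M.X u) (M.measurable_state u) with hκ
  set μ' := (κ ∘ₖ Kernel.const Unit μ) () with hμ'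
  have hle := M.future_le u
  have hD' : MeasurableSet D := M.past_le a u D hD
  have htrim : μ.trim hle = μ'.trim hle := by
    refine @Measure.ext _ (M.future u) _ _ fun A hA => ?_
    rw [trim_measurableSet_eq hle hA, trim_measurableSet_eq hle hA, hμ', Kernel.comp_apply' _ _ _
      (hle A hA), hμ, Measure.restrict_apply (hle A hA), inter_comm,
      M.ν_markov a u g D A hau hD hA]
    rfl
  have hsm : StronglyMeasurable[M.future u] φ := hφ.stronglyMeasurable
  have hint' : Integrable φ μ' := by
    refine integrable_of_integrable_trim hle ?_
    rw [← htrim]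
    exact Integrable.trim hle hint hsm
  calc ∫ ω, φ ω ∂μ = ∫ ω, φ ω ∂μ' := by
        rw [integral_trim hle hsm, htrim, ← integral_trim hle hsm]
    _ = _ := by
        rw [hμ', Kernel.integral_comp hint']
        rfl

/-! ### Staying in a state -/

/-- The event that the process does not leave, up to time `c`, its state at time `a`. -/
def stayEvent (a c : ℝ≥0) : Set Ω := {ω | ∀ s, a ≤ s → s ≤ c → M.X s ω = M.X a ω}

lemma measurableSet_stayEvent_past {a c : ℝ≥0} (hac : a ≤ c) :
    MeasurableSet[M.past a c] (M.stayEvent a c) := by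
  have h := @measurableSet_const_after S _ _ _ _ Ω (M.past a c) (M.stopped a c)
    (M.measurable_stopped hac) (M.continuousWithinAt_stopped a c) (fun _ => a) measurable_const c
  convert h using 1
  ext ω
  simp only [stayEvent, mem_ofPred_eq]
  refine forall_congr' fun s => forall_congr' fun h1 => forall_congr' fun h2 => ?_
  rw [M.stopped_eq h1 h2, M.stopped_eq le_rfl hac]

lemma measurableSet_stayEvent {a c : ℝ≥0} (hac : a ≤ c) : MeasurableSet (M.stayEvent a c) :=
  M.past_le a c _ (M.measurableSet_stayEvent_past hac)

/-- There is almost surely no jump at the fixed time `t` if the process is conditioned on its state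
at that time. -/
lemma ae_not_isJumpTime (t : ℝ≥0) (g : S) :
    ∀ᵐ ω ∂(M.ν t g), ¬ IsJumpTime (fun s => M.X s ω) t := by
  rcases eq_or_ne t 0 with rfl | ht
  · exact Eventually.of_forall fun ω h => lt_irrefl _ h.pos
  have h := M.survival t t g le_rfl
  simp only [Ico_self, Measure.restrict_empty, integral_zero_measure, neg_zero, Real.exp_zero,
    ENNReal.ofReal_one, Icc_self, mem_singleton_iff, forall_eq] at h
  -- this event has probability one; its measurability comes from a left limit along a sequence
  have hnull : NullMeasurableSet {ω | ¬ IsJumpTime (fun s => M.X s ω) t} (M.ν t g) := by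
    obtain ⟨v, -, hvu, hv⟩ := exists_seq_strictMono_tendsto' (pos_iff_ne_zero.2 ht)
    have hv' : Tendsto v atTop (𝓝[<] t) :=
      tendsto_nhdsWithin_of_tendsto_nhds_of_eventually_within _ hv
        (Eventually.of_forall fun k => (hvu k).2)
    have hm : MeasurableSet {ω | ∀ᶠ k in atTop, M.X (v k) ω = M.X t ω} := by
      have : {ω | ∀ᶠ k in atTop, M.X (v k) ω = M.X t ω} =
          ⋃ n, ⋂ k, ⋂ (_ : n ≤ k), {ω | M.X (v k) ω = M.X t ω} := by
        ext ω
        simp [eventually_atTop]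
      rw [this]
      exact MeasurableSet.iUnion fun n => MeasurableSet.iInter fun k => MeasurableSet.iInter
        fun _ => measurableSet_eq_fun (M.measurable_state _) (M.measurable_state _)
    refine hm.nullMeasurableSet.congr ?_
    filter_upwards [M.ν_piecewiseConstant t g] with ω hω
    refine propext ?_
    obtain ⟨y, p, hp, hy⟩ := hω.exists_left (pos_iff_ne_zero.2 ht)
    have hll := leftLim_eq_of_const hp hy
    have hev : ∀ᶠ k in atTop, M.X (v k) ω = Function.leftLim (fun s => M.X s ω) t := by
      filter_upwards [hv'.eventually (Ioo_mem_nhdsLT hp)] with k hk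
      rw [hll, hy _ hk.1 hk.2]
    change (∀ᶠ k in atTop, M.X (v k) ω = M.X t ω) ↔ ¬ IsJumpTime (fun s => M.X s ω) t
    rw [IsJumpTime, not_not]
    constructor
    · intro h1
      obtain ⟨k, hk1, hk2⟩ := (h1.and hev).exists
      exact hk2.symm.trans hk1
    · intro h1
      filter_upwards [hev] with k hk
      rw [hk, h1]
  exact (mem_ae_iff_prob_eq_one₀ hnull).2 h

lemma rate_locallyIntegrable (g : S) : LocallyIntegrable (fun t => M.rate t g) timeMeasure :=
  M.locallyIntegrable_rate g

lemma measure_stayEvent {a c : ℝ≥0} (hac : a ≤ c) (g : S) :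
    (M.ν a g) (M.stayEvent a c) = ENNReal.ofReal (discount (fun t => M.rate t g) a c) := by
  rw [show ENNReal.ofReal (discount (fun t => M.rate t g) a c) = _ from
    (M.survival a c g hac).symm]
  refine measure_congr ?_
  filter_upwards [M.ae_not_isJumpTime a g, M.ν_piecewiseConstant a g] with ω h1 h2
  refine propext ?_
  change (∀ s, a ≤ s → s ≤ c → M.X s ω = M.X a ω) ↔ ∀ s ∈ Icc a c, ¬ IsJumpTime _ s
  constructor
  · rintro h s ⟨has, hsc⟩
    rcases has.eq_or_lt with rfl | hlt
    · exact h1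
    · exact not_isJumpTime_of_const hlt fun w hw hws =>
        (h w hw.le (hws.trans hsc)).trans (h s has hsc).symm
  · intro h s has hsc
    exact eq_of_forall_not_isJumpTime h2 has fun w hw hws => h w ⟨hw.le, hws.trans hsc⟩

variable (r) in
/-- A version of the present value that is measurable with respect to the future of `u`. -/
def futureValue (u : ℝ≥0) (ω : Ω) : ℝ := M.enumeratedValue r u fun s => M.X (max u s) ω

lemma measurable_futureValue (hr : LocallyIntegrable r timeMeasure) (u : ℝ≥0) :
    Measurable[M.future u] (M.futureValue r u) :=
  @measurable_enumeratedValue S _ _ _ _ Ω _ M r Ω (M.future u) (fun s ω => M.X (max u s) ω) hr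
    (fun s => M.measurable_state_future (le_max_left u s))
    (M.continuousWithinAt_state_comp (θ := fun s => max u s) (by fun_prop)
      fun _ _ h => max_le_max_left _ h) u

lemma presentValue_eq_futureValue {u : ℝ≥0} {ω : Ω}
    (hω : IsPiecewiseConstantPath fun s => M.X s ω) (hu : ¬ IsJumpTime (fun s => M.X s ω) u) :
    M.presentValue r u ω = M.futureValue r u ω := by
  rw [presentValue, M.sojournValue_add_transitionValue_eq r hω hu, futureValue]
  exact M.enumeratedValue_congr r fun s hs => by rw [max_eq_right hs]

lemma presentValue_ae_eq_futureValue (u : ℝ≥0) (g : S) :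
    M.presentValue r u =ᵐ[M.ν u g] M.futureValue r u := by
  filter_upwards [M.ae_not_isJumpTime u g, M.ν_piecewiseConstant u g] with ω h1 h2
  exact M.presentValue_eq_futureValue h2 h1

lemma reserve_eq_integral_futureValue (u : ℝ≥0) (g : S) :
    M.reserve r u g = ∫ ω, M.futureValue r u ω ∂(M.ν u g) :=
  integral_congr_ae (M.presentValue_ae_eq_futureValue u g)

/-- The present value itself need not be measurable on paths that are not piecewise constant, but
its version `futureValue` is. -/
lemma measurable_reserve (hr : LocallyIntegrable r timeMeasure) (u : ℝ≥0) :
    Measurable (M.reserve r u) := by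
  have h : Measurable (M.futureValue r u) :=
    (M.measurable_futureValue hr u).mono (M.future_le u) le_rfl
  rw [show M.reserve r u = fun g => ∫ ω, M.futureValue r u ω ∂(M.ν u g) from
    funext fun g => M.reserve_eq_integral_futureValue u g]
  exact h.stronglyMeasurable.integral_kernel.measurable

/-- The contribution to the reserve of the event that the state `g` is not left before `c`. -/
lemma integral_stayEvent (hr : LocallyIntegrable r timeMeasure)
    (hconv : ∀ t g, ∀ᵐ ω ∂(M.ν t g), M.presentVariation r t ω < ∞)
    (hint : ∀ t g, Integrable (M.presentValue r t) (M.ν t g)) {a c : ℝ≥0} (hac : a ≤ c) (g : S) :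
    ∫ ω in M.stayEvent a c, M.presentValue r a ω ∂(M.ν a g) =
      discount (fun t => M.rate t g) a c *
        (M.stayValue r a c g + discount r a c * M.reserve r c g) := by
  have hD := M.measurableSet_stayEvent hac
  have hv := discount_pos r a c
  have hsplit : ∀ᵐ ω ∂(M.ν a g), ω ∈ M.stayEvent a c →
      M.presentValue r a ω = M.stayValue r a c g + discount r a c * M.futureValue r c ω := by
    filter_upwards [M.ae_not_isJumpTime a g, M.ν_piecewiseConstant a g, M.ν_start a g, hconv a g]
      with ω h1 h2 h3 h4 hω
    have hjump : ¬ IsJumpTime (fun s => M.X s ω) c := by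
      rcases hac.eq_or_lt with rfl | hlt
      · exact h1
      · exact not_isJumpTime_of_const hlt fun w hw hwc =>
          (hω w hw.le hwc).trans (hω c hac le_rfl).symm
    rw [← M.presentValue_eq_futureValue h2 hjump]
    exact M.presentValue_split hr hac (fun s hs hsc => (hω s hs hsc.le).trans h3) h1 h4
  have hsplit' : ∀ᵐ ω ∂(M.ν a g).restrict (M.stayEvent a c), M.futureValue r c ω =
      (discount r a c)⁻¹ * (M.presentValue r a ω - M.stayValue r a c g) := by
    filter_upwards [(ae_restrict_iff' hD).2 hsplit] with ω hω
    rw [hω, add_sub_cancel_left, inv_mul_cancel_left₀ hv.ne']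
  have hfi : IntegrableOn (M.futureValue r c) (M.stayEvent a c) (M.ν a g) := by
    refine Integrable.congr ?_ (EventuallyEq.symm hsplit')
    exact ((hint a g).integrableOn.sub (integrable_const _)).const_mul _
  have hmarkov := M.setIntegral_eq_of_markov hac g (M.measurableSet_stayEvent_past hac)
    (M.measurable_futureValue hr c) hfi
  have hreserve : ∫ ω in M.stayEvent a c,
        (∫ ω', M.futureValue r c ω' ∂(M.ν c (M.X c ω))) ∂(M.ν a g) =
      ∫ _ω in M.stayEvent a c, M.reserve r c g ∂(M.ν a g) := by
    refine setIntegral_congr_ae hD ?_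
    filter_upwards [M.ν_start a g] with ω h3 hω
    rw [hω c hac le_rfl, h3, M.reserve_eq_integral_futureValue]
  have hreal : (M.ν a g).real (M.stayEvent a c) = discount (fun t => M.rate t g) a c := by
    rw [measureReal_def, M.measure_stayEvent hac, ENNReal.toReal_ofReal (discount_pos _ _ _).le]
  rw [setIntegral_congr_ae hD hsplit, integral_add (integrable_const _) (hfi.const_mul _),
    integral_const_mul, hmarkov, hreserve]
  simp only [integral_const, measureReal_restrict_apply_univ, hreal, smul_eq_mul]
  ring

/-- Right limits of the reserve: the lump sum `ΔB_h(s)` is contained in `V_h(s)` but not in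
`V_h(s+)`. -/
lemma tendsto_stayValue_add_reserve (hr : LocallyIntegrable r timeMeasure)
    (hconv : ∀ t g, ∀ᵐ ω ∂(M.ν t g), M.presentVariation r t ω < ∞)
    (hint : ∀ t g, Integrable (M.presentValue r t) (M.ν t g)) (s : ℝ≥0) (h : S) :
    Tendsto (fun n => M.stayValue r s (gridSucc n s) h +
      discount r s (gridSucc n s) * M.reserve r (gridSucc n s) h) atTop (𝓝 (M.reserve r s h)) := by
  have hle : ∀ n, s ≤ gridSucc n s := fun n => (lt_gridSucc n s).le
  have h1 : Tendsto (fun n => ∫ ω in M.stayEvent s (gridSucc n s), M.presentValue r s ω ∂(M.ν s h))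
      atTop (𝓝 (M.reserve r s h)) := by
    simp_rw [fun n => (integral_indicator (M.measurableSet_stayEvent (hle n))
      (f := M.presentValue r s) (μ := M.ν s h)).symm]
    refine tendsto_integral_of_dominated_convergence (fun ω => ‖M.presentValue r s ω‖)
      (fun n => (hint s h).aestronglyMeasurable.indicator (M.measurableSet_stayEvent (hle n)))
      (hint s h).norm (fun n => Eventually.of_forall fun ω => norm_indicator_le_norm_self _ _) ?_
    filter_upwards [M.ν_piecewiseConstant s h] with ω hω
    obtain ⟨u, hu, hconst⟩ := hω.exists_right s
    refine tendsto_const_nhds.congr' ?_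
    filter_upwards [(tendsto_gridSucc s).eventually (Ioo_mem_nhdsGT hu)] with n hn
    rw [indicator_of_mem]
    exact fun w hw hwn => hconst w hw (hwn.trans_lt hn.2)
  have h2 : Tendsto (fun n => discount (fun t => M.rate t h) s (gridSucc n s)) atTop (𝓝 1) := by
    rw [← discount_self (fun t => M.rate t h) s]
    exact ((continuous_discount (M.rate_locallyIntegrable h) s).tendsto s).comp
      ((tendsto_gridSucc s).mono_right nhdsWithin_le_nhds)
  have h3 := h1.div h2 one_ne_zero
  rw [div_one] at h3
  refine h3.congr fun n => ?_
  rw [Pi.div_apply, M.integral_stayEvent hr hconv hint (hle n),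
    mul_div_cancel_left₀ _ (discount_pos _ _ _).ne']

end RegularInsuranceModel

/-! ### The law of the first jump -/

lemma firstChange_le_of_eqOn {S : Type*} {x y : ℝ≥0 → S} {q u : ℝ≥0} (hqu : q ≤ u)
    (h : ∀ s, q ≤ s → s ≤ u → x s = y s) (hx : ChangesAfter x q) (hlt : firstChange x q < u) :
    ChangesAfter y q ∧ firstChange y q ≤ firstChange x q := by
  have key : ∀ v, firstChange x q < v → ∃ s, q ≤ s ∧ s < v ∧ y s ≠ y q := by
    intro v hv
    obtain ⟨s, ⟨hqs, hs⟩, hsv⟩ := (csInf_lt_iff (OrderBot.bddBelow _) hx).1 (lt_min hv hlt)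
    refine ⟨s, hqs, hsv.trans_le (min_le_left _ _), ?_⟩
    rwa [← h s hqs (hsv.trans_le (min_le_right _ _)).le, ← h q le_rfl hqu]
  constructor
  · obtain ⟨s, hqs, -, hs⟩ := key u hlt
    exact ⟨s, hqs, hs⟩
  · by_contra hcon
    obtain ⟨s, hqs, hsv, hs⟩ := key _ (not_le.1 hcon)
    exact (not_lt.2 (firstChange_le hqs hs)) hsv

/-- The first change of state depends only on the path up to any later time. -/
lemma firstChange_eq_of_eqOn {S : Type*} {x y : ℝ≥0 → S} {q u : ℝ≥0} (hqu : q ≤ u)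
    (h : ∀ s, q ≤ s → s ≤ u → x s = y s) (hx : ChangesAfter x q) (hlt : firstChange x q < u) :
    ChangesAfter y q ∧ firstChange y q = firstChange x q := by
  have h1 := firstChange_le_of_eqOn hqu h hx hlt
  have h2 := firstChange_le_of_eqOn hqu (fun s hs hsu => (h s hs hsu).symm) h1.1
    (h1.2.trans_lt hlt)
  exact ⟨h1.1, le_antisymm h1.2 h2.2⟩

lemma measurableSet_firstChange_stay {S : Type*} [TopologicalSpace S] [PolishSpace S]
    [MeasurableSpace S] [BorelSpace S] {Ω' : Type*} [MeasurableSpace Ω'] {Y : ℝ≥0 → Ω' → S}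
    (hY : ∀ s, Measurable (Y s))
    (hrc : ∀ ω t, ContinuousWithinAt (fun s => Y s ω) (Ici t) t) (a u : ℝ≥0)
    {A : Set (ℝ≥0 × S)} (hA : MeasurableSet A) :
    MeasurableSet {ω | (ChangesAfter (fun s => Y s ω) a ∧
      (firstChange (fun s => Y s ω) a, Y (firstChange (fun s => Y s ω) a) ω) ∈ A) ∧
      ∀ s, firstChange (fun s => Y s ω) a ≤ s → s ≤ u →
        Y s ω = Y (firstChange (fun s => Y s ω) a) ω} := by
  have h2 := measurable_firstChange hY hrc a
  exact ((measurableSet_changesAfter hY hrc a).inter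
    ((h2.prodMk (measurable_apply_of_rightContinuous hY hrc h2)) hA)).inter
      (measurableSet_const_after hY hrc h2 u)

namespace RegularInsuranceModel

variable {S : Type*} [TopologicalSpace S] [PolishSpace S] [MeasurableSpace S] [BorelSpace S]
  {Ω : Type*} [mΩ : MeasurableSpace Ω] (M : RegularInsuranceModel S Ω) {r : ℝ≥0 → ℝ}

/-- The time of the first jump after `a`. -/
def jumpTime (a : ℝ≥0) (ω : Ω) : ℝ≥0 := firstChange (fun s => M.X s ω) a

/-- The time of the first jump after `a`, and the state reached by it. -/
def jumpMark (a : ℝ≥0) (ω : Ω) : ℝ≥0 × S := (M.jumpTime a ω, M.X (M.jumpTime a ω) ω)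

/-- The event that there is a jump after `a`, and that its time and target state lie in `A`. -/
def jumpEvent (a : ℝ≥0) (A : Set (ℝ≥0 × S)) : Set Ω :=
  {ω | ChangesAfter (fun s => M.X s ω) a ∧ M.jumpMark a ω ∈ A}

lemma measurable_jumpTime (a : ℝ≥0) : Measurable (M.jumpTime a) :=
  measurable_firstChange M.measurable_state (fun ω t => (M.cadlag ω t).1) a

lemma measurable_jumpMark (a : ℝ≥0) : Measurable (M.jumpMark a) :=
  (M.measurable_jumpTime a).prodMk (measurable_apply_of_rightContinuous M.measurable_state
    (fun ω t => (M.cadlag ω t).1) (M.measurable_jumpTime a))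

lemma measurableSet_jumpEvent (a : ℝ≥0) {A : Set (ℝ≥0 × S)} (hA : MeasurableSet A) :
    MeasurableSet (M.jumpEvent a A) :=
  (measurableSet_changesAfter M.measurable_state (fun ω t => (M.cadlag ω t).1) a).inter
    (M.measurable_jumpMark a hA)

/-- The jump intensities `s ↦ q_s(g, ·)` out of a fixed state. -/
def jumpKernel (g : S) : Kernel ℝ≥0 S := M.q.comap (fun s => (s, g)) (by fun_prop)

instance (g : S) : IsSFiniteKernel (M.jumpKernel g) :=
  isSFiniteKernel_of_forall_isFiniteMeasure _ fun s => M.isFiniteMeasure_q s g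

/-- The law, under `P(· | X_a = g)`, of time and target of the first jump after `a`, on the event
that it happens before `c`. -/
def jumpLaw (a c : ℝ≥0) (g : S) : Measure (ℝ≥0 × S) :=
  ((timeMeasure.restrict (Icc a c)).withDensity fun s =>
    ENNReal.ofReal (discount (fun t => M.rate t g) a s)) ⊗ₘ M.jumpKernel g

lemma measurable_survival (a : ℝ≥0) (g : S) :
    Measurable fun s => ENNReal.ofReal (discount (fun t => M.rate t g) a s) :=
  (continuous_discount (M.rate_locallyIntegrable g) a).measurable.ennreal_ofReal

lemma measure_jumpEvent {a u : ℝ≥0} (hau : a ≤ u) (g : S) {C : Set S} (hC : MeasurableSet C) :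
    M.ν a g (M.jumpEvent a (Iic u ×ˢ C)) =
      ∫⁻ s in Icc a u, ENNReal.ofReal (discount (fun t => M.rate t g) a s) *
        M.q (s, g) C ∂timeMeasure := by
  rw [show ∫⁻ s in Icc a u, ENNReal.ofReal (discount (fun t => M.rate t g) a s) *
        M.q (s, g) C ∂timeMeasure = _ from (M.jump_law a u g C hau hC).symm]
  refine measure_congr ?_
  filter_upwards [M.ae_not_isJumpTime a g, M.ν_piecewiseConstant a g] with ω h1 h2
  refine propext ?_
  change (ChangesAfter (fun s => M.X s ω) a ∧ M.jumpTime a ω ≤ u ∧ M.X (M.jumpTime a ω) ω ∈ C) ↔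
    ∃ s ∈ Icc a u, IsFirstJumpTimeFrom (fun w => M.X w ω) a s ∧ M.X s ω ∈ C
  constructor
  · rintro ⟨hc, hu, hC⟩
    refine ⟨M.jumpTime a ω, ⟨le_firstChange hc, hu⟩,
      ⟨le_firstChange hc, (isJumpTime_firstChange h2 hc).2, fun w haw hw => ?_⟩, hC⟩
    rcases haw.eq_or_lt with rfl | hlt
    · exact h1
    · exact not_isJumpTime_of_const hlt fun v hv hvw =>
        (eq_of_lt_firstChange hv.le (hvw.trans_lt hw)).trans
          (eq_of_lt_firstChange haw hw).symm
  · rintro ⟨s, ⟨has, hsu⟩, ⟨-, hj, hfirst⟩, hC⟩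
    have hlt : a < s := has.lt_of_ne (by rintro rfl; exact h1 hj)
    have hconst : ∀ w, a ≤ w → w < s → M.X w ω = M.X a ω := fun w haw hws =>
      eq_of_forall_not_isJumpTime (x := fun w => M.X w ω) h2 haw fun v hv hvw =>
        hfirst v hv.le (hvw.trans_lt hws)
    have hne : M.X s ω ≠ M.X a ω := fun heq =>
      hj ((leftLim_eq_of_const hlt fun w hw hws => hconst w hw.le hws).trans heq.symm)
    have hs : M.jumpTime a ω = s := firstChange_eq hlt hne hconst
    rw [hs]
    exact ⟨⟨s, has, hne⟩, hsu, hC⟩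

/-- The survival and jump laws of the model determine the law of the mark of the first jump, because
the sets `[0, w] × C` form a `π`-system. -/
lemma map_jumpMark (a c : ℝ≥0) (g : S) :
    ((M.ν a g).restrict (M.jumpEvent a (Iic c ×ˢ univ))).map (M.jumpMark a) =
      M.jumpLaw a c g := by
  have hgen := generateFrom_eq_prod (C := range (Iic : ℝ≥0 → Set ℝ≥0))
    (D := {C : Set S | MeasurableSet C})
    (by rw [← borel_eq_generateFrom_Iic]; exact BorelSpace.measurable_eq.symm)
    MeasurableSpace.generateFrom_measurableSet
    ⟨fun n : ℕ => Iic (n : ℝ≥0), fun n => ⟨_, rfl⟩, by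
      ext x
      simpa using exists_nat_ge x⟩ isCountablySpanning_measurableSet
  refine Measure.ext_of_generateFrom_of_iUnion _ (fun n : ℕ => Iic (n : ℝ≥0) ×ˢ univ) hgen.symm
    (isPiSystem_Iic.prod MeasurableSpace.isPiSystem_measurableSet) ?_ ?_ ?_ ?_
  · rw [← iUnion_prod_const]
    have : ⋃ n : ℕ, Iic (n : ℝ≥0) = univ := by
      ext x
      simpa using exists_nat_ge x
    rw [this, univ_prod_univ]
  · exact fun n => ⟨_, ⟨_, rfl⟩, univ, MeasurableSet.univ, rfl⟩
  · exact fun n => measure_ne_top _ _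
  · rintro _ ⟨_, ⟨w, rfl⟩, C, hC, rfl⟩
    have hC : MeasurableSet C := hC
    have hleft : ((M.ν a g).restrict (M.jumpEvent a (Iic c ×ˢ univ))).map (M.jumpMark a)
        (Iic w ×ˢ C) = M.ν a g (M.jumpEvent a (Iic (min w c) ×ˢ C)) := by
      rw [Measure.map_apply (M.measurable_jumpMark a) (measurableSet_Iic.prod hC),
        Measure.restrict_apply (M.measurable_jumpMark a (measurableSet_Iic.prod hC))]
      congr 1
      ext ω
      simp only [jumpEvent, mem_inter_iff, mem_preimage, mem_prod, mem_Iic, mem_univ, and_true,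
        mem_ofPred_eq, le_min_iff]
      tauto
    have hright : M.jumpLaw a c g (Iic w ×ˢ C) =
        ∫⁻ s in Icc a (min w c), ENNReal.ofReal (discount (fun t => M.rate t g) a s) *
          M.q (s, g) C ∂timeMeasure := by
      have hset : Iic w ∩ Icc a c = Icc a (min w c) := by
        ext s
        simp only [mem_inter_iff, mem_Iic, mem_Icc, le_min_iff]
        tauto
      rw [jumpLaw, Measure.compProd_apply_prod measurableSet_Iic hC,
        restrict_withDensity measurableSet_Iic,
        lintegral_withDensity_eq_lintegral_mul _ (M.measurable_survival a g)
          ((M.jumpKernel g).measurable_coe hC), Measure.restrict_restrict measurableSet_Iic, hset]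
      rfl
    rw [hleft, hright]
    rcases le_or_gt a (min w c) with h | h
    · exact M.measure_jumpEvent h g hC
    · rw [Icc_eq_empty (not_le.2 h), Measure.restrict_empty, lintegral_zero_measure]
      convert measure_empty (μ := M.ν a g)
      ext ω
      simp only [jumpEvent, mem_ofPred_eq, mem_empty_iff_false, iff_false]
      rintro ⟨hc, hm⟩
      exact (not_le.2 h) ((le_firstChange hc).trans hm.1)

/-! ### The first-jump decomposition of the reserve -/

lemma measurable_discount_comp (hr : LocallyIntegrable r timeMeasure) {ι : Type*}
    [MeasurableSpace ι] {α β : ι → ℝ≥0} (hα : Measurable α) (hβ : Measurable β) :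
    Measurable fun i => discount r (α i) (β i) := by
  have h0 : Measurable (discount r 0) := (continuous_discount hr 0).measurable
  have heq : (fun i => discount r (α i) (β i)) = fun i =>
      discount r 0 (max (α i) (β i)) / discount r 0 (α i) := by
    ext i
    rw [eq_div_iff (discount_pos _ _ _).ne', mul_comm]
    rcases le_total (α i) (β i) with h | h
    · rw [max_eq_right h, discount_mul_discount hr zero_le h]
    · rw [max_eq_left h, discount_of_le r h, mul_one]
  rw [heq]
  exact (h0.comp (hα.max hβ)).div (h0.comp hα)

lemma measurable_stayValue (hr : LocallyIntegrable r timeMeasure) {ι : Type*}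
    [MeasurableSpace ι] {α β : ι → ℝ≥0} {γ : ι → S} (hα : Measurable α) (hβ : Measurable β)
    (hγ : Measurable γ) : Measurable fun i => M.stayValue r (α i) (β i) (γ i) := by
  refine M.measurable_stieltjesIntegral hγ (A := fun i => Ico (α i) (β i))
    (φ := fun i => discount r (α i)) ?_ ?_
  · have h1 : MeasurableSet {p : ι × ℝ≥0 | α p.1 ≤ p.2} :=
      measurableSet_le (hα.comp measurable_fst) measurable_snd
    have h2 : MeasurableSet {p : ι × ℝ≥0 | p.2 < β p.1} :=
      measurableSet_lt measurable_snd (hβ.comp measurable_fst)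
    exact h1.inter h2
  · exact measurable_discount_comp hr (hα.comp measurable_fst) measurable_snd

lemma measurable_reserve_gridSucc (hr : LocallyIntegrable r timeMeasure) (n : ℕ) :
    Measurable fun z : ℝ≥0 × S => M.reserve r (gridSucc n z.1) z.2 := by
  have h : Measurable fun p : ℕ × S => M.reserve r (gridPoint n p.1) p.2 :=
    measurable_from_prod_countable_right fun k => M.measurable_reserve hr (gridPoint n k)
  have h2 : Measurable fun p : ℝ≥0 × S => (⌊p.1 * (n + 1)⌋₊, p.2) :=
    ((measurable_floor_grid n).comp measurable_fst).prodMk measurable_snd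
  have h3 := h.comp h2
  simp only [Function.comp_def] at h3
  simpa only [gridSucc] using h3

variable (r) in
/-- The discounted payments on `[a, u)` if the state `g` is left by a jump with time and target
`z = (s, h)`, and `h` is not left before `u`. -/
def paymentUntil (a : ℝ≥0) (g : S) (u : ℝ≥0) (z : ℝ≥0 × S) : ℝ :=
  M.stayValue r a z.1 g + discount r a z.1 * (M.b z.1 g z.2 + M.stayValue r z.1 u z.2)

variable (r) in
/-- The conditional expectation of the present value at `a`, given that the state `g` is left by a
jump with time and target `z = (s, h)`. -/
def valueGivenJump (a : ℝ≥0) (g : S) (z : ℝ≥0 × S) : ℝ :=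
  M.stayValue r a z.1 g + discount r a z.1 * (M.b z.1 g z.2 + M.reserve r z.1 z.2)

variable (r) in
/-- The approximation of `valueGivenJump` that waits for the next point of a grid after the jump,
where the Markov property at a fixed time applies. -/
def gridValueGivenJump (a : ℝ≥0) (g : S) (n : ℕ) (z : ℝ≥0 × S) : ℝ :=
  M.paymentUntil r a g (gridSucc n z.1) z +
    discount r a (gridSucc n z.1) * M.reserve r (gridSucc n z.1) z.2

lemma measurable_b_left (g : S) : Measurable fun z : ℝ≥0 × S => M.b z.1 g z.2 := by
  have : Measurable fun z : ℝ≥0 × S => (z.1, g, z.2) := by fun_prop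
  exact M.measurable_b.comp this

lemma measurable_paymentUntil (hr : LocallyIntegrable r timeMeasure) (a : ℝ≥0) (g : S)
    {β : ℝ≥0 × S → ℝ≥0} (hβ : Measurable β) :
    Measurable fun z => M.paymentUntil r a g (β z) z :=
  (M.measurable_stayValue hr measurable_const measurable_fst measurable_const).add
    ((measurable_discount_comp hr measurable_const measurable_fst).mul
      ((M.measurable_b_left g).add (M.measurable_stayValue hr measurable_fst hβ measurable_snd)))

lemma measurable_gridValueGivenJump (hr : LocallyIntegrable r timeMeasure) (a : ℝ≥0) (g : S)
    (n : ℕ) : Measurable (M.gridValueGivenJump r a g n) := by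
  have hgrid : Measurable fun z : ℝ≥0 × S => gridSucc n z.1 :=
    (measurable_gridSucc n).comp measurable_fst
  exact (M.measurable_paymentUntil hr a g hgrid).add
    ((measurable_discount_comp hr measurable_const hgrid).mul (M.measurable_reserve_gridSucc hr n))

/-- The event that the first jump after `a` has its time and target in `A`, and that the state
reached is kept until time `u`. -/
def cellEvent (a u : ℝ≥0) (A : Set (ℝ≥0 × S)) : Set Ω :=
  {ω | ω ∈ M.jumpEvent a A ∧
    ∀ s, M.jumpTime a ω ≤ s → s ≤ u → M.X s ω = M.X (M.jumpTime a ω) ω}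

/-- Whether a cell event occurs is known at time `u`. -/
lemma measurableSet_cellEvent_past {a u : ℝ≥0} (hau : a ≤ u) {A : Set (ℝ≥0 × S)}
    (hA : MeasurableSet A) (hAu : ∀ z ∈ A, z.1 < u) :
    MeasurableSet[M.past a u] (M.cellEvent a u A) := by
  set Y := M.stopped a u
  have h5 := @measurableSet_firstChange_stay S _ _ _ _ Ω (M.past a u) Y (M.measurable_stopped hau)
    (M.continuousWithinAt_stopped a u) a u A hA
  convert h5 using 1
  ext ω
  have hXY : ∀ s, a ≤ s → s ≤ u → M.X s ω = Y s ω := fun s h h' => (M.stopped_eq h h' ω).symm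
  simp only [cellEvent, jumpEvent, jumpMark, mem_ofPred_eq]
  constructor
  · rintro ⟨⟨hc, hz⟩, hconst⟩
    have hlt : M.jumpTime a ω < u := hAu _ hz
    obtain ⟨hc', heq⟩ := firstChange_eq_of_eqOn hau hXY hc hlt
    have ha := le_firstChange hc
    rw [heq]
    refine ⟨⟨hc', ?_⟩, fun s hs hsu => ?_⟩
    · rwa [← hXY _ ha hlt.le]
    · rw [← hXY _ ha hlt.le, ← hXY _ (ha.trans hs) hsu]
      exact hconst s hs hsu
  · rintro ⟨⟨hc, hz⟩, hconst⟩
    have hlt : firstChange (fun s => Y s ω) a < u := hAu _ hz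
    obtain ⟨hc', heq⟩ := firstChange_eq_of_eqOn hau (fun s h h' => (hXY s h h').symm) hc hlt
    have ha := le_firstChange hc
    rw [show M.jumpTime a ω = _ from heq]
    refine ⟨⟨hc', ?_⟩, fun s hs hsu => ?_⟩
    · rwa [hXY _ ha hlt.le]
    · rw [hXY _ ha hlt.le, hXY _ (ha.trans hs) hsu]
      exact hconst s hs hsu

lemma measurableSet_cellEvent (a u : ℝ≥0) {A : Set (ℝ≥0 × S)} (hA : MeasurableSet A) :
    MeasurableSet (M.cellEvent a u A) :=
  measurableSet_firstChange_stay M.measurable_state (fun ω t => (M.cadlag ω t).1) a u hA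

/-- The strong Markov property at the first jump, for the event that the state reached by the jump
is kept until a fixed later time `u`: it follows from the Markov property at `u`. -/
lemma setIntegral_cellEvent (hr : LocallyIntegrable r timeMeasure)
    (hconv : ∀ t g, ∀ᵐ ω ∂(M.ν t g), M.presentVariation r t ω < ∞)
    (hint : ∀ t g, Integrable (M.presentValue r t) (M.ν t g)) (a u : ℝ≥0) (g : S)
    {A : Set (ℝ≥0 × S)} (hA : MeasurableSet A) (hAu : ∀ z ∈ A, z.1 < u) {K L : ℝ}
    (hL : ∀ z ∈ A, |M.paymentUntil r a g u z| ≤ L)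
    (hK : ∀ z ∈ A, |M.paymentUntil r a g u z + discount r a u * M.reserve r u z.2| ≤ K) :
    ∫ ω in M.cellEvent a u A, M.presentValue r a ω ∂(M.ν a g) =
      ∫ ω in M.cellEvent a u A, (M.paymentUntil r a g u (M.jumpMark a ω) +
        discount r a u * M.reserve r u (M.jumpMark a ω).2) ∂(M.ν a g) := by
  rcases le_or_gt a u with hau | hua
  swap
  · have : M.cellEvent a u A = ∅ := by
      ext ω
      simp only [mem_empty_iff_false, iff_false]
      rintro ⟨⟨hc, hz⟩, -⟩
      exact (not_lt.2 hua.le) ((le_firstChange hc).trans_lt (hAu _ hz))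
    simp [this]
  have hDp := M.measurableSet_cellEvent_past hau hA hAu
  have hD : MeasurableSet (M.cellEvent a u A) := M.past_le a u _ hDp
  set D := M.cellEvent a u A with hDdef
  have hv := discount_pos r a u
  set R : Ω → ℝ := fun ω => M.paymentUntil r a g u (M.jumpMark a ω) with hR
  have hRm : Measurable R :=
    (M.measurable_paymentUntil hr a g measurable_const).comp (M.measurable_jumpMark a)
  have hVm : Measurable fun ω => M.reserve r u (M.jumpMark a ω).2 :=
    (M.measurable_reserve hr u).comp (M.measurable_jumpMark a).snd
  have hRi : IntegrableOn R D (M.ν a g) := by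
    refine Measure.integrableOn_of_bounded (measure_ne_top _ _) hRm.aestronglyMeasurable (M := L) ?_
    exact (ae_restrict_iff' hD).2 (Eventually.of_forall fun ω hω => hL _ hω.1.2)
  have hsumi : IntegrableOn (fun ω => R ω + discount r a u * M.reserve r u (M.jumpMark a ω).2) D
      (M.ν a g) := by
    refine Measure.integrableOn_of_bounded (measure_ne_top _ _)
      (hRm.add (hVm.const_mul _)).aestronglyMeasurable (M := K) ?_
    exact (ae_restrict_iff' hD).2 (Eventually.of_forall fun ω hω => hK _ hω.1.2)
  have hsplit : ∀ᵐ ω ∂(M.ν a g), ω ∈ D →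
      M.presentValue r a ω = R ω + discount r a u * M.futureValue r u ω := by
    filter_upwards [M.ae_not_isJumpTime a g, M.ν_piecewiseConstant a g, M.ν_start a g, hconv a g]
      with ω h1 h2 h3 h4 hω
    obtain ⟨⟨hc, hz⟩, hconst⟩ := hω
    have hlt : M.jumpTime a ω < u := hAu _ hz
    have haτ : a ≤ M.jumpTime a ω := le_firstChange hc
    have hjump : ¬ IsJumpTime (fun s => M.X s ω) u :=
      not_isJumpTime_of_const hlt fun w hw hwu =>
        (hconst w hw.le hwu).trans (hconst u hlt.le le_rfl).symm
    have hj := isJumpTime_firstChange h2 hc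
    have hll : Function.leftLim (fun s => M.X s ω) (M.jumpTime a ω) = g := hj.1.trans h3
    rw [← M.presentValue_eq_futureValue h2 hjump,
      M.presentValue_split hr haτ
        (fun s hs hsτ => (eq_of_lt_firstChange (x := fun s => M.X s ω) hs hsτ).trans h3) h1 h4,
      M.presentValue_split_of_isJumpTime hr hlt (fun s hs hsu => hconst s hs hsu.le) hj.2
        (M.presentVariation_lt_top_of_le hr haτ h4), hll,
      ← discount_mul_discount hr haτ hlt.le]
    simp only [hR, paymentUntil, jumpMark]
    ring
  -- integrable because the present value and the bounded payments before `u` are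
  have hfi : IntegrableOn (M.futureValue r u) D (M.ν a g) := by
    refine Integrable.congr (f := fun ω => (discount r a u)⁻¹ * (M.presentValue r a ω - R ω)) ?_ ?_
    · exact ((hint a g).integrableOn.sub hRi).const_mul _
    · filter_upwards [(ae_restrict_iff' hD).2 hsplit] with ω hω
      rw [hω, add_sub_cancel_left, inv_mul_cancel_left₀ hv.ne']
  have hVi : IntegrableOn (fun ω => discount r a u * M.reserve r u (M.jumpMark a ω).2) D
      (M.ν a g) := by
    exact (hsumi.sub hRi).congr (Eventually.of_forall fun ω => add_sub_cancel_left _ _)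
  have hmarkov := M.setIntegral_eq_of_markov hau g hDp (M.measurable_futureValue hr u) hfi
  have hreserve : ∫ ω in D, (∫ ω', M.futureValue r u ω' ∂(M.ν u (M.X u ω))) ∂(M.ν a g) =
      ∫ ω in D, M.reserve r u (M.jumpMark a ω).2 ∂(M.ν a g) := by
    refine setIntegral_congr_fun hD fun ω hω => ?_
    have hlt : M.jumpTime a ω < u := hAu _ hω.1.2
    rw [hω.2 u hlt.le le_rfl, M.reserve_eq_integral_futureValue]
    rfl
  rw [setIntegral_congr_ae hD hsplit, integral_add hRi (hfi.const_mul _), integral_const_mul,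
    hmarkov, hreserve, ← integral_const_mul, ← integral_add hRi hVi]

end RegularInsuranceModel

namespace RegularInsuranceModel

variable {S : Type*} [TopologicalSpace S] [PolishSpace S] [MeasurableSpace S] [BorelSpace S]
  {Ω : Type*} [mΩ : MeasurableSpace Ω] (M : RegularInsuranceModel S Ω) {r : ℝ≥0 → ℝ}

lemma tendsto_gridValueGivenJump (hr : LocallyIntegrable r timeMeasure)
    (hconv : ∀ t g, ∀ᵐ ω ∂(M.ν t g), M.presentVariation r t ω < ∞)
    (hint : ∀ t g, Integrable (M.presentValue r t) (M.ν t g)) {a : ℝ≥0} (g : S) {z : ℝ≥0 × S}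
    (hz : a ≤ z.1) :
    Tendsto (fun n => M.gridValueGivenJump r a g n z) atTop (𝓝 (M.valueGivenJump r a g z)) := by
  have h := (((M.tendsto_stayValue_add_reserve hr hconv hint z.1 z.2).const_add
    (M.b z.1 g z.2)).const_mul (discount r a z.1)).const_add (M.stayValue r a z.1 g)
  refine h.congr fun n => ?_
  rw [gridValueGivenJump, paymentUntil, ← discount_mul_discount hr hz (lt_gridSucc n z.1).le]
  ring

/-- Joint measurability in time and state: the reserve is the limit of its values at the next grid
point, corrected for the payments in between. -/
lemma measurable_reserve_uncurry (hr : LocallyIntegrable r timeMeasure)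
    (hconv : ∀ t g, ∀ᵐ ω ∂(M.ν t g), M.presentVariation r t ω < ∞)
    (hint : ∀ t g, Integrable (M.presentValue r t) (M.ν t g)) :
    Measurable fun z : ℝ≥0 × S => M.reserve r z.1 z.2 := by
  have hlim : Tendsto (fun n (z : ℝ≥0 × S) => M.stayValue r z.1 (gridSucc n z.1) z.2 +
      discount r z.1 (gridSucc n z.1) * M.reserve r (gridSucc n z.1) z.2) atTop
      (𝓝 fun z => M.reserve r z.1 z.2) :=
    tendsto_pi_nhds.2 fun z => M.tendsto_stayValue_add_reserve hr hconv hint z.1 z.2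
  refine measurable_of_tendsto_metrizable (fun n => ?_) hlim
  have hgrid : Measurable fun z : ℝ≥0 × S => gridSucc n z.1 :=
    (measurable_gridSucc n).comp measurable_fst
  exact (M.measurable_stayValue hr measurable_fst hgrid measurable_snd).add
    ((measurable_discount_comp hr measurable_fst hgrid).mul (M.measurable_reserve_gridSucc hr n))

lemma measurable_valueGivenJump (hr : LocallyIntegrable r timeMeasure)
    (hconv : ∀ t g, ∀ᵐ ω ∂(M.ν t g), M.presentVariation r t ω < ∞)
    (hint : ∀ t g, Integrable (M.presentValue r t) (M.ν t g)) (a : ℝ≥0) (g : S) :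
    Measurable (M.valueGivenJump r a g) :=
  (M.measurable_stayValue hr measurable_const measurable_fst measurable_const).add
    ((measurable_discount_comp hr measurable_const measurable_fst).mul
      ((M.measurable_b_left g).add (M.measurable_reserve_uncurry hr hconv hint)))

/-- The event that the first jump after `a` has its time and target in `A`, and that the state
reached is kept until the next point of the `n`-th grid. -/
def gridEvent (a : ℝ≥0) (n : ℕ) (A : Set (ℝ≥0 × S)) : Set Ω :=
  {ω | ω ∈ M.jumpEvent a A ∧ ∀ s, M.jumpTime a ω ≤ s → s ≤ gridSucc n (M.jumpTime a ω) →
    M.X s ω = M.X (M.jumpTime a ω) ω}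

variable (r) in
/-- The part of `A` with jump times between consecutive grid points and payments of comparable
size. -/
def gridCell (a : ℝ≥0) (g : S) (n : ℕ) (A : Set (ℝ≥0 × S)) (p : ℕ × ℕ) : Set (ℝ≥0 × S) :=
  {z | z ∈ A ∧ ⌊z.1 * (n + 1)⌋₊ = p.1 ∧ ⌊|M.paymentUntil r a g (gridSucc n z.1) z|⌋₊ = p.2}

lemma measurableSet_gridCell (hr : LocallyIntegrable r timeMeasure) (a : ℝ≥0) (g : S) (n : ℕ)
    {A : Set (ℝ≥0 × S)} (hA : MeasurableSet A) (p : ℕ × ℕ) :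
    MeasurableSet (M.gridCell r a g n A p) := by
  have h1 : Measurable fun z : ℝ≥0 × S => ⌊z.1 * (n + 1)⌋₊ :=
    (measurable_floor_grid n).comp measurable_fst
  have h2 : Measurable fun z : ℝ≥0 × S => ⌊|M.paymentUntil r a g (gridSucc n z.1) z|⌋₊ :=
    Nat.measurable_floor.comp (measurable_norm.comp
      (M.measurable_paymentUntil hr a g ((measurable_gridSucc n).comp measurable_fst)))
  exact hA.inter ((h1 (measurableSet_singleton p.1)).inter (h2 (measurableSet_singleton p.2)))

lemma gridSucc_of_mem_gridCell {a : ℝ≥0} {g : S} {n : ℕ} {A : Set (ℝ≥0 × S)} {p : ℕ × ℕ}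
    {z : ℝ≥0 × S} (hz : z ∈ M.gridCell r a g n A p) : gridSucc n z.1 = gridPoint n p.1 := by
  rw [gridSucc, hz.2.1]

lemma gridEvent_eq_iUnion (r : ℝ≥0 → ℝ) (a : ℝ≥0) (g : S) (n : ℕ) (A : Set (ℝ≥0 × S)) :
    M.gridEvent a n A = ⋃ p, M.cellEvent a (gridPoint n p.1) (M.gridCell r a g n A p) := by
  ext ω
  simp only [mem_iUnion]
  constructor
  · rintro ⟨⟨hc, hz⟩, h⟩
    refine ⟨(⌊(M.jumpMark a ω).1 * (n + 1)⌋₊,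
      ⌊|M.paymentUntil r a g (gridSucc n (M.jumpMark a ω).1) (M.jumpMark a ω)|⌋₊), ?_⟩
    have hmem : M.jumpMark a ω ∈ M.gridCell r a g n A (⌊(M.jumpMark a ω).1 * (n + 1)⌋₊,
      ⌊|M.paymentUntil r a g (gridSucc n (M.jumpMark a ω).1) (M.jumpMark a ω)|⌋₊) := ⟨hz, rfl, rfl⟩
    refine ⟨⟨hc, hmem⟩, ?_⟩
    have heq := M.gridSucc_of_mem_gridCell hmem
    exact fun s hs hsu => h s hs (hsu.trans_eq heq.symm)
  · rintro ⟨p, ⟨hc, hz⟩, h⟩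
    have heq : gridSucc n (M.jumpMark a ω).1 = gridPoint n p.1 := M.gridSucc_of_mem_gridCell hz
    exact ⟨⟨hc, hz.1⟩, fun s hs hsu => h s hs (hsu.trans_eq heq)⟩

/-- The strong Markov property at the first jump, if the state reached is kept until the next grid
point: the cells are disjoint, and in each of them the next grid point is a fixed time. -/
lemma setIntegral_gridEvent (hr : LocallyIntegrable r timeMeasure)
    (hconv : ∀ t g, ∀ᵐ ω ∂(M.ν t g), M.presentVariation r t ω < ∞)
    (hint : ∀ t g, Integrable (M.presentValue r t) (M.ν t g)) (a : ℝ≥0) (g : S) (n : ℕ)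
    {A : Set (ℝ≥0 × S)} (hA : MeasurableSet A) {K : ℝ}
    (hK : ∀ z ∈ A, |M.gridValueGivenJump r a g n z| ≤ K) :
    ∫ ω in M.gridEvent a n A, M.presentValue r a ω ∂(M.ν a g) =
      ∫ ω in M.gridEvent a n A, M.gridValueGivenJump r a g n (M.jumpMark a ω) ∂(M.ν a g) := by
  have hcell := M.measurableSet_gridCell hr a g n hA
  have hm : ∀ p, MeasurableSet (M.cellEvent a (gridPoint n p.1) (M.gridCell r a g n A p)) :=
    fun p => M.measurableSet_cellEvent a _ (hcell p)
  have hunion := M.gridEvent_eq_iUnion r a g n A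
  have hd : Pairwise (Function.onFun Disjoint fun p : ℕ × ℕ =>
      M.cellEvent a (gridPoint n p.1) (M.gridCell r a g n A p)) := by
    intro p p' hpp
    refine Set.disjoint_left.2 fun ω h h' => hpp ?_
    exact Prod.ext (h.1.2.2.1.symm.trans h'.1.2.2.1) (h.1.2.2.2.symm.trans h'.1.2.2.2)
  have hbound : IntegrableOn (fun ω => M.gridValueGivenJump r a g n (M.jumpMark a ω))
      (M.gridEvent a n A) (M.ν a g) := by
    refine Measure.integrableOn_of_bounded (measure_ne_top _ _) ((M.measurable_gridValueGivenJump
      hr a g n).comp (M.measurable_jumpMark a)).aestronglyMeasurable (M := K) ?_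
    have hD : MeasurableSet (M.gridEvent a n A) := hunion ▸ MeasurableSet.iUnion hm
    exact (ae_restrict_iff' hD).2 (Eventually.of_forall fun ω hω => hK _ hω.1.2)
  rw [hunion] at hbound ⊢
  rw [integral_iUnion hm hd (hint a g).integrableOn, integral_iUnion hm hd hbound]
  refine tsum_congr fun p => ?_
  rw [M.setIntegral_cellEvent hr hconv hint a (gridPoint n p.1) g (hcell p) (K := K)
    (L := p.2 + 1)]
  · refine setIntegral_congr_fun (hm p) fun ω hω => ?_
    rw [gridValueGivenJump, M.gridSucc_of_mem_gridCell hω.1.2]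
  · exact fun z hz => M.gridSucc_of_mem_gridCell hz ▸ lt_gridSucc n z.1
  · intro z hz
    rw [← M.gridSucc_of_mem_gridCell hz, ← hz.2.2]
    exact (Nat.lt_floor_add_one _).le
  · intro z hz
    rw [← M.gridSucc_of_mem_gridCell hz]
    exact hK z hz.1

/-- Since paths are piecewise constant, almost every outcome in the jump event lies in all but
finitely many of the grid events. -/
lemma tendsto_setIntegral_gridEvent {a : ℝ≥0} {g : S} {A : Set (ℝ≥0 × S)} (hA : MeasurableSet A)
    (hgrid : ∀ n, MeasurableSet (M.gridEvent a n A)) {f : ℕ → Ω → ℝ} {f' G : Ω → ℝ}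
    (hf : ∀ n, AEStronglyMeasurable (f n) (M.ν a g)) (hG : Integrable G (M.ν a g))
    (hfG : ∀ n, ∀ ω ∈ M.jumpEvent a A, |f n ω| ≤ G ω)
    (hlim : ∀ ω ∈ M.jumpEvent a A, Tendsto (fun n => f n ω) atTop (𝓝 (f' ω))) :
    Tendsto (fun n => ∫ ω in M.gridEvent a n A, f n ω ∂(M.ν a g)) atTop
      (𝓝 (∫ ω in M.jumpEvent a A, f' ω ∂(M.ν a g))) := by
  simp_rw [fun n => (integral_indicator (hgrid n) (f := f n) (μ := M.ν a g)).symm,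
    ← integral_indicator (M.measurableSet_jumpEvent a hA)]
  refine tendsto_integral_of_dominated_convergence (fun ω => |G ω|)
    (fun n => (hf n).indicator (hgrid n)) hG.abs (fun n => Eventually.of_forall fun ω => ?_) ?_
  · by_cases hω : ω ∈ M.gridEvent a n A
    · rw [indicator_of_mem hω]
      exact (hfG n ω hω.1).trans (le_abs_self _)
    · rw [indicator_of_notMem hω, norm_zero]
      exact abs_nonneg _
  · filter_upwards [M.ν_piecewiseConstant a g] with ω hω
    by_cases hE : ω ∈ M.jumpEvent a A
    · rw [indicator_of_mem hE]
      obtain ⟨u, hu, hconst⟩ := hω.exists_right (M.jumpTime a ω)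
      refine (hlim ω hE).congr' ?_
      filter_upwards [(tendsto_gridSucc (M.jumpTime a ω)).eventually (Ioo_mem_nhdsGT hu)] with n hn
      rw [indicator_of_mem]
      exact ⟨hE, fun w hw hwn => hconst w hw (hwn.trans_lt hn.2)⟩
    · rw [indicator_of_notMem hE]
      refine tendsto_const_nhds.congr fun n => ?_
      rw [indicator_of_notMem fun h => hE h.1]

/-- The strong Markov property at the first jump, for marks with bounded approximations. -/
lemma setIntegral_jumpEvent_of_bounded (hr : LocallyIntegrable r timeMeasure)
    (hconv : ∀ t g, ∀ᵐ ω ∂(M.ν t g), M.presentVariation r t ω < ∞)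
    (hint : ∀ t g, Integrable (M.presentValue r t) (M.ν t g)) (a : ℝ≥0) (g : S)
    {A : Set (ℝ≥0 × S)} (hA : MeasurableSet A) {K : ℝ}
    (hK : ∀ z ∈ A, ∀ n, |M.gridValueGivenJump r a g n z| ≤ K) :
    ∫ ω in M.jumpEvent a A, M.presentValue r a ω ∂(M.ν a g) =
      ∫ ω in M.jumpEvent a A, M.valueGivenJump r a g (M.jumpMark a ω) ∂(M.ν a g) := by
  have hgrid : ∀ n, MeasurableSet (M.gridEvent a n A) := fun n => by
    rw [M.gridEvent_eq_iUnion r a g n A]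
    exact MeasurableSet.iUnion fun p =>
      M.measurableSet_cellEvent a _ (M.measurableSet_gridCell hr a g n hA p)
  have h1 := M.tendsto_setIntegral_gridEvent (g := g) hA hgrid
    (f := fun _ => M.presentValue r a) (fun _ => (hint a g).aestronglyMeasurable)
    (hint a g).norm (fun _ _ _ => le_rfl) (fun _ _ => tendsto_const_nhds)
  have h2 := M.tendsto_setIntegral_gridEvent (g := g) hA hgrid
    (f := fun n ω => M.gridValueGivenJump r a g n (M.jumpMark a ω))
    (f' := fun ω => M.valueGivenJump r a g (M.jumpMark a ω)) (G := fun _ => K)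
    (fun n => ((M.measurable_gridValueGivenJump hr a g n).comp
      (M.measurable_jumpMark a)).aestronglyMeasurable) (integrable_const _)
    (fun n ω hω => hK _ hω.2 n) fun ω hω =>
      M.tendsto_gridValueGivenJump hr hconv hint g (le_firstChange hω.1)
  refine tendsto_nhds_unique h1 (h2.congr fun n => ?_)
  exact (M.setIntegral_gridEvent hr hconv hint a g n hA fun z hz => hK z hz n).symm

variable (r) in
/-- The marks for which all approximations of the value after the jump are bounded by `K`. -/
def boundedMarks (a : ℝ≥0) (g : S) (K : ℕ) : Set (ℝ≥0 × S) :=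
  {z | ∀ n, |M.gridValueGivenJump r a g n z| ≤ K}

lemma measurableSet_boundedMarks (hr : LocallyIntegrable r timeMeasure) (a : ℝ≥0) (g : S)
    (K : ℕ) : MeasurableSet (M.boundedMarks r a g K) :=
  measurableSet_setOfPred.2 <| Measurable.forall fun n => measurableSet_setOfPred.1 <|
    measurableSet_le (measurable_norm.comp (M.measurable_gridValueGivenJump hr a g n))
      measurable_const

/-- The strong Markov property at the first jump. Integrability after the jump is part of the
claim: it is inherited from the present value at `a`. -/
theorem integrableOn_valueGivenJump_and_setIntegral_eq (hr : LocallyIntegrable r timeMeasure)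
    (hconv : ∀ t g, ∀ᵐ ω ∂(M.ν t g), M.presentVariation r t ω < ∞)
    (hint : ∀ t g, Integrable (M.presentValue r t) (M.ν t g)) (a : ℝ≥0) (g : S)
    {A : Set (ℝ≥0 × S)} (hA : MeasurableSet A) :
    IntegrableOn (fun ω => M.valueGivenJump r a g (M.jumpMark a ω)) (M.jumpEvent a A) (M.ν a g) ∧
    ∫ ω in M.jumpEvent a A, M.presentValue r a ω ∂(M.ν a g) =
      ∫ ω in M.jumpEvent a A, M.valueGivenJump r a g (M.jumpMark a ω) ∂(M.ν a g) := by
  set E := M.jumpEvent a A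
  set μ := (M.ν a g).restrict E
  set Φ : Ω → ℝ := fun ω => M.valueGivenJump r a g (M.jumpMark a ω)
  set φ : ℕ → Set Ω := fun K => M.jumpMark a ⁻¹' M.boundedMarks r a g K
  have hmark := M.measurable_jumpMark a
  have hB := M.measurableSet_boundedMarks hr a g
  have hΦz := M.measurable_valueGivenJump hr hconv hint a g
  have hΦ : Measurable Φ := hΦz.comp hmark
  have hφm : ∀ K, MeasurableSet (φ K) := fun K => hmark (hB K)
  have hpv : Integrable (M.presentValue r a) μ := (hint a g).integrableOn
  -- on the marks with bounded approximations, intersected with any measurable set of marks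
  have key : ∀ K (C : Set (ℝ≥0 × S)), MeasurableSet C →
      ∫ ω in M.jumpMark a ⁻¹' C ∩ φ K, M.presentValue r a ω ∂μ =
        ∫ ω in M.jumpMark a ⁻¹' C ∩ φ K, Φ ω ∂μ := by
    intro K C hC
    have h := M.setIntegral_jumpEvent_of_bounded hr hconv hint a g
      (hA.inter (hC.inter (hB K))) fun z hz => hz.2.2
    have hset : M.jumpEvent a (A ∩ (C ∩ M.boundedMarks r a g K)) =
        (M.jumpMark a ⁻¹' C ∩ φ K) ∩ E := by
      ext ω
      simp only [E, φ, jumpEvent, mem_inter_iff, mem_ofPred_eq, mem_preimage]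
      tauto
    rw [hset] at h
    rwa [Measure.restrict_restrict ((hmark hC).inter (hφm K))]
  -- the approximations converge at every mark, so they are bounded there
  have hcover : AECover μ atTop φ := by
    refine ⟨?_, hφm⟩
    refine (ae_restrict_iff' (M.measurableSet_jumpEvent a hA)).2 (Eventually.of_forall ?_)
    intro ω hω
    obtain ⟨L, hL⟩ := (M.tendsto_gridValueGivenJump hr hconv hint g (z := M.jumpMark a ω)
      (le_firstChange hω.1)).abs.bddAbove_range
    obtain ⟨N, hN⟩ := exists_nat_ge L
    filter_upwards [eventually_ge_atTop N] with K hK n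
    exact (hL ⟨n, rfl⟩).trans (hN.trans (Nat.cast_le.2 hK))
  have hΦK : ∀ K, IntegrableOn Φ (φ K) μ := by
    intro K
    refine Measure.integrableOn_of_bounded (measure_ne_top _ _) hΦ.aestronglyMeasurable
      (M := (K : ℝ)) ?_
    refine (ae_restrict_iff' (hφm K)).2 ((ae_restrict_iff' (M.measurableSet_jumpEvent a hA)).2
      (Eventually.of_forall fun ω hω hK => ?_))
    exact le_of_tendsto (M.tendsto_gridValueGivenJump hr hconv hint g (le_firstChange hω.1)).abs
      (Eventually.of_forall hK)
  have hΦint : Integrable Φ μ := by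
    -- with `key` on the sign sets of `Φ`, its norm integrates to at most that of the present value
    refine hcover.integrable_of_integral_norm_bounded (∫ ω, |M.presentValue r a ω| ∂μ) hΦK
      (Eventually.of_forall fun K => ?_)
    have hpos : MeasurableSet {z | 0 ≤ M.valueGivenJump r a g z} :=
      measurableSet_le measurable_const hΦz
    set P := M.jumpMark a ⁻¹' {z | 0 ≤ M.valueGivenJump r a g z} with hP
    have hPm : MeasurableSet P := hmark hpos
    have h1 := key K _ hpos
    have h2 := key K _ hpos.compl
    rw [← Measure.restrict_restrict hPm] at h1
    rw [preimage_compl, ← Measure.restrict_restrict hPm.compl] at h2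
    have hnorm : ∫ ω in φ K, ‖Φ ω‖ ∂μ = (∫ ω in P, Φ ω ∂μ.restrict (φ K)) -
        ∫ ω in Pᶜ, Φ ω ∂μ.restrict (φ K) := by
      rw [← integral_add_compl hPm (hΦK K).norm, sub_eq_add_neg, ← integral_neg]
      congr 1
      · exact setIntegral_congr_fun hPm fun ω hω => abs_of_nonneg hω
      · exact setIntegral_congr_fun hPm.compl fun ω hω => abs_of_neg (not_le.1 hω)
    have hpvK : Integrable (M.presentValue r a) (μ.restrict (φ K)) := hpv.restrict
    rw [hnorm, ← h1, ← h2]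
    calc _ ≤ (∫ ω in P, |M.presentValue r a ω| ∂μ.restrict (φ K)) +
          ∫ ω in Pᶜ, |M.presentValue r a ω| ∂μ.restrict (φ K) := by
          rw [sub_eq_add_neg, ← integral_neg]
          exact add_le_add (integral_mono hpvK.restrict hpvK.abs.restrict fun ω => le_abs_self _)
            (integral_mono hpvK.restrict.neg hpvK.abs.restrict fun ω => neg_le_abs _)
      _ = ∫ ω in φ K, |M.presentValue r a ω| ∂μ := integral_add_compl hPm hpvK.abs
      _ ≤ _ := setIntegral_le_integral hpv.abs (Eventually.of_forall fun ω => abs_nonneg _)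
  refine ⟨hΦint, ?_⟩
  refine tendsto_nhds_unique (hcover.integral_tendsto_of_countably_generated hpv)
    ((hcover.integral_tendsto_of_countably_generated hΦint).congr fun K => ?_)
  have h := key K univ MeasurableSet.univ
  rw [preimage_univ, univ_inter] at h
  exact h.symm

lemma integrable_valueGivenJump (hr : LocallyIntegrable r timeMeasure)
    (hconv : ∀ t g, ∀ᵐ ω ∂(M.ν t g), M.presentVariation r t ω < ∞)
    (hint : ∀ t g, Integrable (M.presentValue r t) (M.ν t g)) (a c : ℝ≥0) (g : S) :
    Integrable (M.valueGivenJump r a g) (M.jumpLaw a c g) := by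
  rw [← map_jumpMark, integrable_map_measure
    (M.measurable_valueGivenJump hr hconv hint a g).aestronglyMeasurable
    (M.measurable_jumpMark a).aemeasurable]
  exact (M.integrableOn_valueGivenJump_and_setIntegral_eq hr hconv hint a g
    (measurableSet_Iic.prod MeasurableSet.univ)).1

/-- The decomposition of the reserve at the first jump after `a`, or at `c` if there is no jump
before. -/
theorem reserve_eq_add_integral_jumpLaw (hr : LocallyIntegrable r timeMeasure)
    (hconv : ∀ t g, ∀ᵐ ω ∂(M.ν t g), M.presentVariation r t ω < ∞)
    (hint : ∀ t g, Integrable (M.presentValue r t) (M.ν t g)) {a c : ℝ≥0} (hac : a ≤ c) (g : S) :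
    M.reserve r a g =
      discount (fun t => M.rate t g) a c *
        (M.stayValue r a c g + discount r a c * M.reserve r c g) +
      ∫ z, M.valueGivenJump r a g z ∂(M.jumpLaw a c g) := by
  have hcompl : (M.stayEvent a c)ᶜ =ᵐ[M.ν a g] M.jumpEvent a (Iic c ×ˢ univ) := by
    filter_upwards [M.ν_piecewiseConstant a g] with ω hω
    refine propext ?_
    change ¬ (∀ s, a ≤ s → s ≤ c → M.X s ω = M.X a ω) ↔ (ChangesAfter (fun s => M.X s ω) a ∧
      M.jumpTime a ω ≤ c ∧ True)
    constructor
    · intro h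
      push Not at h
      obtain ⟨s, has, hsc, hne⟩ := h
      exact ⟨⟨s, has, hne⟩, (firstChange_le has hne).trans hsc, trivial⟩
    · rintro ⟨hc, hle, -⟩ h
      exact apply_firstChange_ne hω hc (h _ (le_firstChange hc) hle)
  have hjump : ∫ ω in (M.stayEvent a c)ᶜ, M.presentValue r a ω ∂(M.ν a g) =
      ∫ ω in M.jumpEvent a (Iic c ×ˢ univ), M.presentValue r a ω ∂(M.ν a g) :=
    setIntegral_congr_set hcompl
  rw [reserve, ← integral_add_compl (M.measurableSet_stayEvent hac) (hint a g),
    M.integral_stayEvent hr hconv hint hac g, hjump,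
    (M.integrableOn_valueGivenJump_and_setIntegral_eq hr hconv hint a g
      (measurableSet_Iic.prod MeasurableSet.univ)).2, ← map_jumpMark,
    integral_map (M.measurable_jumpMark a).aemeasurable
      (M.measurable_valueGivenJump hr hconv hint a g).aestronglyMeasurable]

end RegularInsuranceModel

/-! ### Integration by parts -/

/-- Integration by parts for the product of a discount factor and a primitive with respect to a
measure that may have atoms. It follows from Fubini's theorem. -/
lemma integration_by_parts {ρ : ℝ≥0 → ℝ} (hρ : LocallyIntegrable ρ timeMeasure) {μ : Measure ℝ≥0}
    [SFinite μ] {φ : ℝ≥0 → ℝ} {a c : ℝ≥0} (hφ : IntegrableOn φ (Ico a c) μ) :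
    IntegrableOn (fun s => ρ s * discount ρ a s * ∫ w in Ico a s, φ w ∂μ) (Ico a c) timeMeasure ∧
    ∫ s in Ico a c, ρ s * discount ρ a s * ∫ w in Ico a s, φ w ∂μ ∂timeMeasure =
      ∫ w in Ico a c, (discount ρ a w - discount ρ a c) * φ w ∂μ := by
  have he : IntegrableOn (fun s => ρ s * discount ρ a s) (Ico a c) timeMeasure :=
    ((hρ.integrableOn_Icc_nnreal a c).mul_continuousOn
      (continuous_discount hρ a).continuousOn isCompact_Icc).mono_set Ico_subset_Icc_self
  set F : ℝ≥0 × ℝ≥0 → ℝ :=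
    {p | p.2 < p.1}.indicator fun p => ρ p.1 * discount ρ a p.1 * φ p.2
  have hF : Integrable F ((timeMeasure.restrict (Ico a c)).prod (μ.restrict (Ico a c))) :=
    (Integrable.mul_prod he hφ).indicator (measurableSet_lt measurable_snd measurable_fst)
  have hin : ∀ s ∈ Ico a c, ∫ w in Ico a c, F (s, w) ∂μ =
      ρ s * discount ρ a s * ∫ w in Ico a s, φ w ∂μ := by
    intro s hs
    have h1 : (fun w => F (s, w)) = (Iio s).indicator fun w => ρ s * discount ρ a s * φ w := rfl
    have h2 : Ico a c ∩ Iio s = Ico a s := by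
      rw [Ico_inter_Iio, min_eq_right hs.2.le]
    rw [h1, setIntegral_indicator measurableSet_Iio, h2, integral_const_mul]
  have hout : ∀ w ∈ Ico a c, ∫ s in Ico a c, F (s, w) ∂timeMeasure =
      (discount ρ a w - discount ρ a c) * φ w := by
    intro w hw
    have h1 : (fun s => F (s, w)) = (Ioi w).indicator fun s => ρ s * discount ρ a s * φ w := rfl
    have h2 : Ico a c ∩ Ioi w = Ioo w c := by
      ext s
      simp only [mem_inter_iff, mem_Ico, mem_Ioi, mem_Ioo]
      exact ⟨fun h => ⟨h.2, h.1.2⟩, fun h => ⟨⟨hw.1.trans h.1.le, h.2⟩, h.1⟩⟩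
    rw [h1, setIntegral_indicator measurableSet_Ioi, h2, integral_mul_const,
      setIntegral_congr_set Ioo_ae_eq_Ico, setIntegral_mul_discount hρ hw.1 hw.2.le]
  constructor
  · exact hF.integral_prod_left.congr
      ((ae_restrict_iff' measurableSet_Ico).2 (Eventually.of_forall hin))
  · rw [← setIntegral_congr_fun measurableSet_Ico hin,
      ← setIntegral_congr_fun measurableSet_Ico hout]
    exact integral_integral_swap hF

lemma integration_by_parts_stieltjes {ρ : ℝ≥0 → ℝ} (hρ : LocallyIntegrable ρ timeMeasure)
    (f : ℝ≥0 → ℝ) {φ : ℝ≥0 → ℝ} (hφ : Continuous φ) (a c : ℝ≥0) :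
    IntegrableOn (fun s => ρ s * discount ρ a s * stieltjesIntegral f (Ico a s) φ) (Ico a c)
      timeMeasure ∧
    ∫ s in Ico a c, ρ s * discount ρ a s * stieltjesIntegral f (Ico a s) φ ∂timeMeasure =
      stieltjesIntegral f (Ico a c) (fun w => discount ρ a w * φ w) -
        discount ρ a c * stieltjesIntegral f (Ico a c) φ := by
  have hcont : Continuous fun w => discount ρ a w * φ w := (continuous_discount hρ a).mul hφ
  have hp := integration_by_parts hρ
    ((hφ.locallyIntegrable (μ := stieltjesPos f)).integrableOn_Ico_nnreal a c)
  have hn := integration_by_parts hρ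
    ((hφ.locallyIntegrable (μ := stieltjesNeg f)).integrableOn_Ico_nnreal a c)
  have heq : ∀ μ : Measure ℝ≥0, IsLocallyFiniteMeasure μ →
      ∫ w in Ico a c, (discount ρ a w - discount ρ a c) * φ w ∂μ =
        (∫ w in Ico a c, discount ρ a w * φ w ∂μ) - discount ρ a c * ∫ w in Ico a c, φ w ∂μ := by
    intro μ _
    simp_rw [sub_mul]
    rw [integral_sub ((hcont.locallyIntegrable (μ := μ)).integrableOn_Ico_nnreal a c)
      (((hφ.locallyIntegrable (μ := μ)).integrableOn_Ico_nnreal a c).const_mul _),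
      integral_const_mul]
  simp only [stieltjesIntegral, mul_sub]
  refine ⟨hp.1.sub hn.1, ?_⟩
  rw [integral_sub hp.1 hn.1, hp.2, hn.2, heq _ inferInstance, heq _ inferInstance]
  ring

/-! ### Thiele's equation -/

namespace RegularInsuranceModel

variable {S : Type*} [TopologicalSpace S] [PolishSpace S] [MeasurableSpace S] [BorelSpace S]
  {Ω : Type*} [mΩ : MeasurableSpace Ω] (M : RegularInsuranceModel S Ω) {r : ℝ≥0 → ℝ}

variable (r) in
/-- The rate `∫ (b_{gh}(t) + V_h(t)) q_t(g, dh)` at which jumps out of `g` generate value. -/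
def jumpValue (t : ℝ≥0) (g : S) : ℝ := ∫ h, (M.b t g h + M.reserve r t h) ∂(M.q (t, g))

lemma real_univ_q (t : ℝ≥0) (g : S) : (M.q (t, g)).real univ = M.rate t g := by
  have h : univ =ᵐ[M.q (t, g)] ({g}ᶜ : Set S) := by
    refine (ae_eq_univ.2 ?_).symm
    rw [compl_compl]
    exact M.q_self t g
  rw [rate, measureReal_def, measureReal_def, measure_congr h]

lemma integral_valueGivenJump_right {a t : ℝ≥0} {g : S}
    (h : Integrable (fun h => M.b t g h + M.reserve r t h) (M.q (t, g))) :
    ∫ h, M.valueGivenJump r a g (t, h) ∂(M.q (t, g)) =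
      M.rate t g * M.stayValue r a t g + discount r a t * M.jumpValue r t g := by
  have := M.isFiniteMeasure_q t g
  simp only [valueGivenJump]
  rw [integral_add (integrable_const _) (h.const_mul _), integral_const, integral_const_mul,
    M.real_univ_q, jumpValue, smul_eq_mul]

lemma ae_integrable_jumpValue (hr : LocallyIntegrable r timeMeasure)
    (hconv : ∀ t g, ∀ᵐ ω ∂(M.ν t g), M.presentVariation r t ω < ∞)
    (hint : ∀ t g, Integrable (M.presentValue r t) (M.ν t g)) (a c : ℝ≥0) (g : S) :
    ∀ᵐ t ∂(timeMeasure.restrict (Icc a c)),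
      Integrable (fun h => M.b t g h + M.reserve r t h) (M.q (t, g)) := by
  have hΦ := M.integrable_valueGivenJump hr hconv hint a c g
  have h := ((Measure.integrable_compProd_iff hΦ.aestronglyMeasurable).1 hΦ).1
  rw [ae_withDensity_iff (M.measurable_survival a g)] at h
  filter_upwards [h] with t ht
  have h1 : Integrable (fun h => M.valueGivenJump r a g (t, h)) (M.q (t, g)) :=
    ht (ENNReal.ofReal_pos.2 (discount_pos _ _ _)).ne'
  have := M.isFiniteMeasure_q t g
  refine ((h1.sub (integrable_const (M.stayValue r a t g))).const_mul (discount r a t)⁻¹).congr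
    (Eventually.of_forall fun h => ?_)
  simp only [valueGivenJump, Pi.sub_apply]
  rw [add_sub_cancel_left, inv_mul_cancel_left₀ (discount_pos r a t).ne']

/-- Thiele's equation in integrated and discounted form: payments and jumps are discounted both
with the interest rate and with the jump rate. -/
theorem discounted_thiele (hr : LocallyIntegrable r timeMeasure)
    (hconv : ∀ t g, ∀ᵐ ω ∂(M.ν t g), M.presentVariation r t ω < ∞)
    (hint : ∀ t g, Integrable (M.presentValue r t) (M.ν t g)) {a c : ℝ≥0} (hac : a ≤ c) (g : S) :
    IntegrableOn (fun t => M.jumpValue r t g) (Icc a c) timeMeasure ∧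
    M.reserve r a g =
      stieltjesIntegral (fun t => M.B t g) (Ico a c) (discount (fun t => M.rate t g + r t) a) +
      (∫ t in Ico a c, discount (fun t => M.rate t g + r t) a t * M.jumpValue r t g ∂timeMeasure) +
      discount (fun t => M.rate t g + r t) a c * M.reserve r c g := by
  set l : ℝ≥0 → ℝ := fun t => M.rate t g with hldef
  have hl : LocallyIntegrable l timeMeasure := M.rate_locallyIntegrable g
  have hlr : LocallyIntegrable (fun t => l t + r t) timeMeasure := hl.add hr
  have hE : ∀ s, discount (fun t => l t + r t) a s = discount l a s * discount r a s :=
    fun s => discount_add hl hr a s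
  have hparts := integration_by_parts_stieltjes hl (fun t => M.B t g) (continuous_discount hr a) a c
  have hΦ := M.integrable_valueGivenJump hr hconv hint a c g
  have hq := M.ae_integrable_jumpValue hr hconv hint a c g
  have hfin : ∀ᵐ s ∂timeMeasure.restrict (Icc a c), ENNReal.ofReal (discount l a s) < ∞ :=
    Eventually.of_forall fun s => ENNReal.ofReal_lt_top
  have hcongr : (fun t => (ENNReal.ofReal (discount l a t)).toReal •
        ∫ h, M.valueGivenJump r a g (t, h) ∂(M.jumpKernel g t)) =ᵐ[timeMeasure.restrict (Icc a c)]
      fun t => l t * discount l a t * M.stayValue r a t g +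
        discount (fun t => l t + r t) a t * M.jumpValue r t g := by
    filter_upwards [hq] with t ht
    rw [ENNReal.toReal_ofReal (discount_pos _ _ _).le, smul_eq_mul, hE]
    rw [show ∫ h, M.valueGivenJump r a g (t, h) ∂(M.jumpKernel g t) = _ from
      M.integral_valueGivenJump_right ht]
    ring
  have hIco : timeMeasure.restrict (Icc a c) = timeMeasure.restrict (Ico a c) :=
    Measure.restrict_congr_set Ico_ae_eq_Icc.symm
  have hsum : Integrable (fun t => l t * discount l a t * M.stayValue r a t g +
      discount (fun t => l t + r t) a t * M.jumpValue r t g) (timeMeasure.restrict (Ico a c)) := by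
    have h : Integrable (fun t => ∫ h, M.valueGivenJump r a g (t, h) ∂(M.jumpKernel g t))
        ((timeMeasure.restrict (Icc a c)).withDensity fun s =>
          ENNReal.ofReal (discount l a s)) := by
      rw [jumpLaw, Measure.compProd] at hΦ
      exact hΦ.integral_compProd
    rw [integrable_withDensity_iff_integrable_smul' (M.measurable_survival a g) hfin] at h
    rw [← hIco]
    exact h.congr hcongr
  have hstay : IntegrableOn (fun t => l t * discount l a t * M.stayValue r a t g) (Ico a c)
      timeMeasure := hparts.1
  have hjump : IntegrableOn (fun t => discount (fun t => l t + r t) a t * M.jumpValue r t g)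
      (Ico a c) timeMeasure :=
    (hsum.sub hstay).congr (Eventually.of_forall fun t => add_sub_cancel_left _ _)
  constructor
  · have hinv : Continuous fun t => (discount (fun t => l t + r t) a t)⁻¹ :=
      (continuous_discount hlr a).inv₀ fun t => (discount_pos _ _ _).ne'
    rw [IntegrableOn, ← hIco] at hjump
    refine (IntegrableOn.continuousOn_mul hinv.continuousOn hjump isCompact_Icc).congr
      (Eventually.of_forall fun t => ?_)
    exact inv_mul_cancel_left₀ (discount_pos _ _ _).ne' _
  · have hlaw : ∫ z, M.valueGivenJump r a g z ∂(M.jumpLaw a c g) =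
        (∫ t in Ico a c, l t * discount l a t * M.stayValue r a t g ∂timeMeasure) +
        ∫ t in Ico a c, discount (fun t => l t + r t) a t * M.jumpValue r t g ∂timeMeasure := by
      rw [← integral_add hstay hjump, ← hIco, ← integral_congr_ae hcongr,
        ← integral_withDensity_eq_integral_toReal_smul (M.measurable_survival a g) hfin]
      exact Measure.integral_compProd hΦ
    have hB : ∫ t in Ico a c, l t * discount l a t * M.stayValue r a t g ∂timeMeasure = _ :=
      hparts.2
    have hfun : (fun w => discount l a w * discount r a w) = discount (fun t => l t + r t) a :=
      (funext hE).symm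
    rw [hfun] at hB
    rw [M.reserve_eq_add_integral_jumpLaw hr hconv hint hac g, hlaw, hB, stayValue]
    linear_combination (-M.reserve r c g) * hE c

end RegularInsuranceModel

end

/-- Thiele's equation, as an equation between Stieltjes differentials: `V_g` is left continuous
(`V(t)` includes the payments at time `t`), so `dV_g` has mass `V_g(c) - V_g(a)` on `[a, c)`. -/
theorem theorem1 {S : Type*} [TopologicalSpace S] [PolishSpace S] [MeasurableSpace S]
    [BorelSpace S] {Ω : Type*} [MeasurableSpace Ω] (M : RegularInsuranceModel S Ω)
    (r : ℝ≥0 → ℝ) (hr : LocallyIntegrable r timeMeasure)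
    (hconv : ∀ t g, ∀ᵐ ω ∂(M.ν t g), M.presentVariation r t ω < ∞)
    (hint : ∀ t g, Integrable (M.presentValue r t) (M.ν t g))
    (g : S) (a c : ℝ≥0) (hac : a ≤ c) :
    IntegrableOn (fun t => (M.rate t g + r t) * M.reserve r t g) (Ico a c) timeMeasure ∧
    (∀ᵐ t ∂(timeMeasure.restrict (Ico a c)),
      Integrable (fun h => M.b t g h + M.reserve r t h) (M.q (t, g))) ∧
    IntegrableOn (fun t => ∫ h, (M.b t g h + M.reserve r t h) ∂(M.q (t, g))) (Ico a c) timeMeasure ∧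
    M.reserve r c g - M.reserve r a g =
      (∫ t in Ico a c, (M.rate t g + r t) * M.reserve r t g ∂timeMeasure)
        - stieltjesIntegral (fun t => M.B t g) (Ico a c) (fun _ => 1)
        - ∫ t in Ico a c, ∫ h, (M.b t g h + M.reserve r t h) ∂(M.q (t, g)) ∂timeMeasure := by
  set ρ : ℝ≥0 → ℝ := fun t => -(M.rate t g + r t) with hρdef
  set E : ℝ≥0 → ℝ := discount (fun t => M.rate t g + r t) a with hE
  set e : ℝ≥0 → ℝ := discount ρ a with he
  set k : ℝ≥0 → ℝ := fun t => M.jumpValue r t g with hk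
  set V : ℝ≥0 → ℝ := fun t => M.reserve r t g with hV
  have hlr : LocallyIntegrable (fun t => M.rate t g + r t) timeMeasure :=
    (M.rate_locallyIntegrable g).add hr
  have hρ : LocallyIntegrable ρ timeMeasure := hlr.neg
  have heE : ∀ t, e t * E t = 1 := fun t => by
    rw [he, hρdef, discount_neg]
    exact inv_mul_cancel₀ (discount_pos _ _ _).ne'
  have hEcont : Continuous E := continuous_discount hlr a
  have hkint : IntegrableOn k (Ico a c) timeMeasure :=
    (M.discounted_thiele hr hconv hint hac g).1.mono_set Ico_subset_Icc_self
  have hEk : IntegrableOn (fun t => E t * k t) (Ico a c) timeMeasure :=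
    (IntegrableOn.continuousOn_mul hEcont.continuousOn
      (M.discounted_thiele hr hconv hint hac g).1 isCompact_Icc).mono_set Ico_subset_Icc_self
  obtain ⟨hB1, hB2⟩ := integration_by_parts_stieltjes hρ (fun t => M.B t g) hEcont a c
  obtain ⟨hk1, hk2⟩ := integration_by_parts hρ hEk
  have hρe : IntegrableOn (fun t => ρ t * e t) (Ico a c) timeMeasure :=
    ((hρ.integrableOn_Icc_nnreal a c).mul_continuousOn
      (continuous_discount hρ a).continuousOn isCompact_Icc).mono_set Ico_subset_Icc_self
  -- the discounted equation, solved for the reserve at the later time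
  have hsol : ∀ t, a ≤ t → V t = e t * (V a -
      stieltjesIntegral (fun t => M.B t g) (Ico a t) E -
        ∫ s in Ico a t, E s * k s ∂timeMeasure) := by
    intro t hat
    have h := (M.discounted_thiele hr hconv hint hat g).2
    have h' : V a = stieltjesIntegral (fun t => M.B t g) (Ico a t) E +
        (∫ s in Ico a t, E s * k s ∂timeMeasure) + E t * V t := h
    rw [h']
    linear_combination (-V t) * heE t
  have hadd : IntegrableOn (fun t => ρ t * e t * stieltjesIntegral (fun t => M.B t g) (Ico a t) E +
      (ρ t * e t * ∫ s in Ico a t, E s * k s ∂timeMeasure)) (Ico a c) timeMeasure := hB1.add hk1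
  have hint' : IntegrableOn (fun t => ρ t * e t * stieltjesIntegral (fun t => M.B t g) (Ico a t) E +
      (ρ t * e t * ∫ s in Ico a t, E s * k s ∂timeMeasure) - V a * (ρ t * e t)) (Ico a c)
      timeMeasure := hadd.sub (hρe.const_mul _)
  have hcongr : EqOn (fun t => ρ t * e t * stieltjesIntegral (fun t => M.B t g) (Ico a t) E +
      (ρ t * e t * ∫ s in Ico a t, E s * k s ∂timeMeasure) - V a * (ρ t * e t))
      (fun t => (M.rate t g + r t) * V t) (Ico a c) := by
    intro t ht
    simp only [hsol t ht.1, hρdef]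
    ring
  refine ⟨hint'.congr_fun hcongr measurableSet_Ico, ?_, hkint, ?_⟩
  · exact ae_restrict_of_ae_restrict_of_subset Ico_subset_Icc_self
      (M.ae_integrable_jumpValue hr hconv hint a c g)
  have hk3 : ∫ w in Ico a c, (e w - e c) * (E w * k w) ∂timeMeasure =
      (∫ w in Ico a c, k w ∂timeMeasure) - e c * ∫ w in Ico a c, E w * k w ∂timeMeasure := by
    rw [← integral_const_mul, ← integral_sub hkint (hEk.const_mul _)]
    refine integral_congr_ae (Eventually.of_forall fun w => ?_)
    linear_combination (k w) * heE w
  have hB3 : stieltjesIntegral (fun t => M.B t g) (Ico a c) (fun w => e w * E w) =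
      stieltjesIntegral (fun t => M.B t g) (Ico a c) fun _ => 1 := by
    simp only [heE]
  have htotal : ∫ t in Ico a c, (M.rate t g + r t) * V t ∂timeMeasure =
      stieltjesIntegral (fun t => M.B t g) (Ico a c) (fun _ => 1) -
        e c * stieltjesIntegral (fun t => M.B t g) (Ico a c) E +
      ((∫ w in Ico a c, k w ∂timeMeasure) - e c * ∫ w in Ico a c, E w * k w ∂timeMeasure) -
      V a * (1 - e c) := by
    rw [← setIntegral_congr_fun measurableSet_Ico hcongr, integral_sub hadd
      (hρe.const_mul _), integral_add hB1 hk1, integral_const_mul, hB2, hk2, hB3, hk3,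
      setIntegral_mul_discount hρ le_rfl hac, discount_self]
  have hVc := hsol c hac
  change V c - V a = (∫ t in Ico a c, (M.rate t g + r t) * V t ∂timeMeasure) - _ -
    ∫ t in Ico a c, k t ∂timeMeasure
  rw [htotal]
  linear_combination hVc
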